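/- Let $G$ be a countable discrete group. Work with approximate semantics (Henson–Iovino) in the two-sorted language $L_G$ of complex Hilbert spaces expanded by unary functions $\tau_g$ ($g\in G$): the sorts are the space and the complex field, and the terms are built from variables of both sorts, the vector $0$, constants for the rational numbers and for $i$, addition, scalar multiplication, multiplication and conjugation of scalars, the inner product $\langle\cdot,\cdot\rangle$, the norm and the $\tau_g$. An $L_G$-structure is a complex Banach space with functions $\langle\cdot,\cdot\rangle$ and $\tau_g$ that are uniformly continuous on bounded sets; the scalar sort is always interpreted as $\mathbb C$. Positive bounded formulas are built from atomic formulas $\operatorname{Re} t\le p$ and $\operatorname{Re} t\ge p$ ($t$ a scalar term, $p\in\mathbb Q$) by conjunction, disjunction and the bounded quantifiers $\exists_r x$, $\forall_r x$ ($\|x\|\le r$, $r$ a positive rational) over both sorts. An approximation $\varphi'$ of $\varphi$ is obtained by strictly relaxing every atomic condition, strictly enlarging the bound of every $\exists_r$ and strictly decreasing the (positive) bound of every $\forall_r$. Write $M\models_{\mathcal A}\varphi$ if $M\models\varphi'$ for every approximation $\varphi'$ of $\varphi$; a model of a set of sentences is a structure that satisfies all of them in the sense of $\models_{\mathcal A}$;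 and $\mathrm{Th}_{\mathcal A}(M)=\{\sigma: M\models_{\mathcal A}\sigma\}$. Let $T_G$ consist of the axioms saying that the space is a Hilbert space and that $g\mapsto\tau_g$ is a unitary representation of $G$ on it. Let $\lambda_G$ be the left regular representation of $G$ on $\ell^2(G)$, let $\infty\lambda_G$ on $H_{\infty\lambda_G}$ be the direct sum of countably infinitely many copies of it, and let $T_{GA}=\mathrm{Th}_{\mathcal A}(H_{\infty\lambda_G},+,\langle\cdot,\cdot\rangle,\infty\lambda_G)$. Let $\Sigma_G$ be the set of existential positive bounded sentences (a block of bounded existential quantifiers followed by a quantifier-free formula) true in $(H_{\infty\lambda_G},+,\langle\cdot,\cdot\rangle,\infty\lambda_G)$, and let $\Sigma_G^-$ be the set of all approximations of sentences in $\Sigma_G$. Theorem. Suppose that $G$ is amenable. Then: 1. $T_{GA}$ has quantifier elimination: for every positive bounded formula $\varphi(\bar x)$, every approximation $\varphi'$ of $\varphi$ and every rational $R>0$ there are a quantifier-free positive bounded formula $\psi(\bar x)$ and an approximation $\psi'$ of $\psi$ such that, for every model $M$ of $T_{GA}$ and every tuple $\bar a$ in $M$ with all entries of norm at most $R$, $M\models\varphi(\bar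 a)$ implies $M\models\psi(\bar a)$, and $M\models\psi'(\bar a)$ implies $M\models\varphi'(\bar a)$. 2. $T_{GA}$ is axiomatized by $T_G\cup\Sigma_G^-$: an $L_G$-structure is a model of $T_{GA}$ if and only if it is a model of $T_G\cup\Sigma_G^-$. 3. $T_{GA}$ is the model companion of $T_G$: every model of $T_G$ embeds in a model of $T_{GA}$, every model of $T_{GA}$ embeds in a model of $T_G$, and $T_{GA}$ is model complete, i.e. for every embedding $f:M\to N$ of models of $T_{GA}$, every positive bounded formula $\varphi$ and every tuple $\bar a$ in $M$, $M\models_{\mathcal A}\varphi(\bar a)$ if and only if $N\models_{\mathcal A}\varphi(f(\bar a))$ (scalar entries of $\bar a$ being left fixed). -/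

import Mathlib

universe u v w

noncomputable section

namespace HilbRep

/-! ### Amenable groups, unitary representations, the regular representation -/

/-- A discrete group is amenable if there is a left-invariant mean on `ℓ^∞(G)`: a positive
normalized linear functional that takes the same value at `f` and at the translate
`x ↦ f (g⁻¹ x)`. -/
def IsAmenable (G : Type u) [Group G] : Prop :=
  ∃ mean : lp (fun _ : G => ℝ) ⊤ →ₗ[ℝ] ℝ,
    mean 1 = 1 ∧
    (∀ f : lp (fun _ : G => ℝ) ⊤, (∀ x, 0 ≤ f x) → 0 ≤ mean f) ∧
    ∀ (g : G) (f f' : lp (fun _ : G => ℝ) ⊤), (∀ x, f' x = f (g⁻¹ * x)) → mean f' = mean f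

/-- A unitary representation of `G` on `H`: a homomorphism into the unitary group of `H`. -/
abbrev UnitaryRep (G : Type u) [Group G] (H : Type v) [NormedAddCommGroup H]
    [InnerProductSpace ℂ H] : Type (max u v) :=
  G →* (H ≃ₗᵢ[ℂ] H)

/-- The Hilbert space `ℓ²(G)`. -/
abbrev ellTwo (G : Type u) : Type u := lp (fun _ : G => ℂ) 2

theorem norm_sq_eq_tsum {ι : Type u} {E : ι → Type v} [∀ i, NormedAddCommGroup (E i)]
    (f : lp E 2) : ‖f‖ ^ 2 = ∑' i, ‖f i‖ ^ 2 := by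
  have h := lp.norm_rpow_eq_tsum (p := 2) (by norm_num) f
  simpa using h

theorem memlp_two_iff {ι : Type u} {E : ι → Type v} [∀ i, NormedAddCommGroup (E i)]
    (f : ∀ i, E i) : Memℓp f 2 ↔ Summable fun i => ‖f i‖ ^ 2 := by
  have h := memℓp_gen_iff (p := 2) (by norm_num) (f := f)
  simpa using h

/-- The translate `h ↦ f (g⁻¹ h)` of `f ∈ ℓ²(G)`. -/
def translate {G : Type u} [Group G] (g : G) (f : ellTwo G) : ellTwo G :=
  ⟨fun h => f (g⁻¹ * h), by
    have hf : Summable fun h => ‖f h‖ ^ 2 := (memlp_two_iff _).1 f.2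
    exact (memlp_two_iff (E := fun _ : G => ℂ) _).2
      (hf.comp_injective (mul_right_injective g⁻¹))⟩

theorem translate_apply {G : Type u} [Group G] (g : G) (f : ellTwo G) (h : G) :
    translate g f h = f (g⁻¹ * h) := rfl

/-- The translation by `g` as a unitary operator on `ℓ²(G)`. -/
def translateEquiv {G : Type u} [Group G] (g : G) : ellTwo G ≃ₗᵢ[ℂ] ellTwo G where
  toFun := translate g
  invFun := translate g⁻¹
  map_add' f f' := by ext h; rfl
  map_smul' c f := by ext h; rfl
  left_inv f := by ext h; simp [translate_apply]
  right_inv f := by ext h; simp [translate_apply]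
  norm_map' f := by
    have h : ‖translate g f‖ ^ 2 = ‖f‖ ^ 2 := by
      rw [norm_sq_eq_tsum, norm_sq_eq_tsum]
      exact (Equiv.mulLeft g⁻¹).tsum_eq (fun h => ‖f h‖ ^ 2)
    exact (sq_eq_sq₀ (norm_nonneg _) (norm_nonneg _)).1 h

/-- The left regular representation `λ_G` of `G` on `ℓ²(G)`. -/
def regularRep (G : Type u) [Group G] : UnitaryRep G (ellTwo G) where
  toFun g := translateEquiv g
  map_one' := by
    ext f h
    change f (1⁻¹ * h) = f h
    simp
  map_mul' g g' := by
    ext f h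
    change f ((g * g')⁻¹ * h) = f (g'⁻¹ * (g⁻¹ * h))
    simp [mul_assoc]

/-- The coordinatewise application of unitary operators on a Hilbert sum. -/
def sumMap {ι : Type u} {E : ι → Type v} [∀ i, NormedAddCommGroup (E i)]
    [∀ i, InnerProductSpace ℂ (E i)] (U : ∀ i, E i ≃ₗᵢ[ℂ] E i) (f : lp E 2) : lp E 2 :=
  ⟨fun i => U i (f i), by
    have hf : Summable fun i => ‖f i‖ ^ 2 := (memlp_two_iff _).1 f.2
    exact (memlp_two_iff _).2 (by simpa using hf)⟩

theorem sumMap_apply {ι : Type u} {E : ι → Type v} [∀ i, NormedAddCommGroup (E i)]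
    [∀ i, InnerProductSpace ℂ (E i)] (U : ∀ i, E i ≃ₗᵢ[ℂ] E i) (f : lp E 2) (i : ι) :
    sumMap U f i = U i (f i) := rfl

/-- The direct sum of unitary operators as a unitary operator on the Hilbert sum. -/
def sumEquiv {ι : Type u} {E : ι → Type v} [∀ i, NormedAddCommGroup (E i)]
    [∀ i, InnerProductSpace ℂ (E i)] (U : ∀ i, E i ≃ₗᵢ[ℂ] E i) : lp E 2 ≃ₗᵢ[ℂ] lp E 2 where
  toFun := sumMap U
  invFun := sumMap fun i => (U i).symm
  map_add' f f' := by ext i; exact map_add (U i) (f i) (f' i)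
  map_smul' c f := by ext i; exact map_smul (U i) c (f i)
  left_inv f := by ext i; simp [sumMap_apply]
  right_inv f := by ext i; simp [sumMap_apply]
  norm_map' f := by
    have h : ‖sumMap U f‖ ^ 2 = ‖f‖ ^ 2 := by
      rw [norm_sq_eq_tsum, norm_sq_eq_tsum]
      simp [sumMap_apply]
    exact (sq_eq_sq₀ (norm_nonneg _) (norm_nonneg _)).1 h

/-- The direct sum `⊕ᵢ πᵢ` of a family of unitary representations. -/
def directSum {G : Type w} [Group G] {ι : Type u} {E : ι → Type v}
    [∀ i, NormedAddCommGroup (E i)] [∀ i, InnerProductSpace ℂ (E i)]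
    (π : ∀ i, UnitaryRep G (E i)) : UnitaryRep G (lp E 2) where
  toFun g := sumEquiv fun i => π i g
  map_one' := by
    ext f i
    change (π i 1) (f i) = f i
    simp
  map_mul' g g' := by
    ext f i
    change (π i (g * g')) (f i) = (π i g) ((π i g') (f i))
    simp

/-- The Hilbert space of `∞λ_G`. -/
abbrev InftyRegularSpace (G : Type u) : Type u := lp (fun _ : ℕ => ellTwo G) 2

/-- The representation `∞λ_G`, the direct sum of countably many copies of `λ_G`. -/
def inftyRegularRep (G : Type u) [Group G] : UnitaryRep G (InftyRegularSpace G) :=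
  directSum fun _ : ℕ => regularRep G

/-! ### Structures -/

/-- Structures for the language `L_G` of Hilbert spaces with unary functions `τ_g`, `g ∈ G`: a
complex Banach space with a binary complex-valued function and unary functions `τ_g`, all
uniformly continuous on bounded sets. The scalar sort is always the complex field. No axiom of
Hilbert spaces or of representations is built in: these make up the theory `theoryTG`. -/
structure LGStructure (G : Type u) where
  carrier : Type v
  [normedAddCommGroup : NormedAddCommGroup carrier]
  [normedSpace : NormedSpace ℂ carrier]
  [completeSpace : CompleteSpace carrier]
  ip : carrier → carrier → ℂ
  act : G → carrier → carrier
  ip_uniformContinuousOn : ∀ r : ℝ,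
    UniformContinuousOn (fun p : carrier × carrier => ip p.1 p.2) (Metric.closedBall 0 r)
  act_uniformContinuousOn : ∀ (g : G) (r : ℝ),
    UniformContinuousOn (act g) (Metric.closedBall 0 r)

attribute [instance] LGStructure.normedAddCommGroup LGStructure.normedSpace
  LGStructure.completeSpace

theorem inner_uniformContinuousOn {H : Type v} [NormedAddCommGroup H] [InnerProductSpace ℂ H]
    (r : ℝ) : UniformContinuousOn (fun p : H × H => inner ℂ p.1 p.2) (Metric.closedBall 0 r) := by
  rw [Metric.uniformContinuousOn_iff]
  intro ε hε
  refine ⟨ε / (2 * (|r| + 1)), by positivity, ?_⟩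
  rintro ⟨x, y⟩ hx ⟨x', y'⟩ hx' hd
  simp only [Metric.mem_closedBall, dist_zero_right, Prod.norm_mk, sup_le_iff] at hx hx'
  rw [Prod.dist_eq, max_lt_iff, dist_eq_norm, dist_eq_norm] at hd
  have h : inner ℂ x y - inner ℂ x' y' = inner ℂ (x - x') y + inner ℂ x' (y - y') := by
    rw [inner_sub_left, inner_sub_right]; ring
  have hr : r ≤ |r| := le_abs_self r
  have hpos : 0 < |r| + 1 := by positivity
  rw [dist_eq_norm, h]
  calc ‖inner ℂ (x - x') y + inner ℂ x' (y - y')‖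
      ≤ ‖x - x'‖ * ‖y‖ + ‖x'‖ * ‖y - y'‖ :=
        (norm_add_le _ _).trans (add_le_add (norm_inner_le_norm _ _) (norm_inner_le_norm _ _))
    _ ≤ ‖x - x'‖ * (|r| + 1) + (|r| + 1) * ‖y - y'‖ := by
        gcongr <;> linarith [hx.2, hx'.1]
    _ < ε / (2 * (|r| + 1)) * (|r| + 1) + (|r| + 1) * (ε / (2 * (|r| + 1))) := by
        have h1 := mul_lt_mul_of_pos_right hd.1 hpos
        have h2 := mul_lt_mul_of_pos_left hd.2 hpos
        exact add_lt_add h1 h2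
    _ = ε := by field_simp; ring

/-- The structure `(H, +, ⟨,⟩, π(g) : g ∈ G)` of a unitary representation. -/
abbrev ofRep {G : Type u} [Group G] {H : Type v} [NormedAddCommGroup H] [InnerProductSpace ℂ H]
    [CompleteSpace H] (π : UnitaryRep G H) : LGStructure.{u, v} G where
  carrier := H
  ip x y := inner ℂ x y
  act g x := π g x
  ip_uniformContinuousOn := inner_uniformContinuousOn
  act_uniformContinuousOn g _ := (π g).isometry.uniformContinuous.uniformContinuousOn

/-- The structure `(H_{∞λ_G}, +, ⟨,⟩, ∞λ_G)`. -/
def inftyRegular (G : Type u) [Group G] : LGStructure.{u, u} G := ofRep (inftyRegularRep G)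

/-! ### Terms and positive bounded formulas -/

/-- The two sorts: the Hilbert space and the complex field. -/
inductive Srt : Type
  | vec
  | scal

/-- Terms of `L_G` with `m` variables of the Hilbert space sort and `n` scalar variables. -/
inductive Term (G : Type u) (m n : ℕ) : Srt → Type u
  | vvar (i : Fin m) : Term G m n .vec
  | vzero : Term G m n .vec
  | vadd (s t : Term G m n .vec) : Term G m n .vec
  | vsmul (a : Term G m n .scal) (s : Term G m n .vec) : Term G m n .vec
  | vact (g : G) (s : Term G m n .vec) : Term G m n .vec
  | svar (j : Fin n) : Term G m n .scal
  | srat (q : ℚ) : Term G m n .scal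
  | simag : Term G m n .scal
  | sadd (a b : Term G m n .scal) : Term G m n .scal
  | smul (a b : Term G m n .scal) : Term G m n .scal
  | sconj (a : Term G m n .scal) : Term G m n .scal
  | sinner (s t : Term G m n .vec) : Term G m n .scal
  | snorm (s : Term G m n .vec) : Term G m n .scal

/-- The interpretation of the sorts in a structure (`ULift` only adjusts the universe). -/
def Srt.interp {G : Type u} (M : LGStructure.{u, v} G) : Srt → Type v
  | .vec => M.carrier
  | .scal => ULift.{v} ℂ

/-- The value of a term. -/
def Term.eval {G : Type u} {m n : ℕ} (M : LGStructure.{u, v} G) (x : Fin m → M.carrier)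
    (z : Fin n → ℂ) : {s : Srt} → Term G m n s → s.interp M
  | _, .vvar i => x i
  | _, .vzero => (0 : M.carrier)
  | _, .vadd s t =>
      let a : M.carrier := s.eval M x z
      let b : M.carrier := t.eval M x z
      a + b
  | _, .vsmul a s =>
      let c : ULift.{v} ℂ := a.eval M x z
      let b : M.carrier := s.eval M x z
      c.down • b
  | _, .vact g s => M.act g (s.eval M x z)
  | _, .svar j => ULift.up (z j)
  | _, .srat q => ULift.up (q : ℂ)
  | _, .simag => ULift.up Complex.I
  | _, .sadd a b =>
      let c : ULift.{v} ℂ := a.eval M x z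
      let d : ULift.{v} ℂ := b.eval M x z
      ULift.up (c.down + d.down)
  | _, .smul a b =>
      let c : ULift.{v} ℂ := a.eval M x z
      let d : ULift.{v} ℂ := b.eval M x z
      ULift.up (c.down * d.down)
  | _, .sconj a =>
      let c : ULift.{v} ℂ := a.eval M x z
      ULift.up (star c.down)
  | _, .sinner s t => ULift.up (M.ip (s.eval M x z) (t.eval M x z))
  | _, .snorm s =>
      let a : M.carrier := s.eval M x z
      ULift.up ((‖a‖ : ℝ) : ℂ)

/-- The value of a scalar term as a complex number. -/
def Term.scalar {G : Type u} {m n : ℕ} (M : LGStructure.{u, v} G) (x : Fin m → M.carrier)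
    (z : Fin n → ℂ) (t : Term G m n .scal) : ℂ :=
  ULift.down (t.eval M x z)

/-- Positive rational numbers, the bounds of quantifiers. -/
abbrev PosRat : Type := {q : ℚ // 0 < q}

/-- Positive bounded formulas with `m` free vector variables and `n` free scalar variables.
The atomic formulas are `Re t ≤ p` and `Re t ≥ p` for scalar terms `t` and rational `p`; all
quantifiers are bounded by a positive rational. A quantifier binds the variable with index `0`
of its sort. -/
inductive Formula (G : Type u) : ℕ → ℕ → Type u
  | le {m n : ℕ} (t : Term G m n .scal) (p : ℚ) : Formula G m n
  | ge {m n : ℕ} (t : Term G m n .scal) (p : ℚ) : Formula G m n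
  | and {m n : ℕ} (φ ψ : Formula G m n) : Formula G m n
  | or {m n : ℕ} (φ ψ : Formula G m n) : Formula G m n
  | exV {m n : ℕ} (r : PosRat) (φ : Formula G (m + 1) n) : Formula G m n
  | allV {m n : ℕ} (r : PosRat) (φ : Formula G (m + 1) n) : Formula G m n
  | exS {m n : ℕ} (r : PosRat) (φ : Formula G m (n + 1)) : Formula G m n
  | allS {m n : ℕ} (r : PosRat) (φ : Formula G m (n + 1)) : Formula G m n

/-- Satisfaction of a positive bounded formula. -/
def Formula.Realize {G : Type u} (M : LGStructure.{u, v} G) :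
    {m n : ℕ} → Formula G m n → (Fin m → M.carrier) → (Fin n → ℂ) → Prop
  | _, _, .le t p, x, z => (t.scalar M x z).re ≤ (p : ℝ)
  | _, _, .ge t p, x, z => (p : ℝ) ≤ (t.scalar M x z).re
  | _, _, .and φ ψ, x, z => φ.Realize M x z ∧ ψ.Realize M x z
  | _, _, .or φ ψ, x, z => φ.Realize M x z ∨ ψ.Realize M x z
  | _, _, .exV r φ, x, z =>
      ∃ y : M.carrier, ‖y‖ ≤ ((r : ℚ) : ℝ) ∧ φ.Realize M (Matrix.vecCons y x) z
  | _, _, .allV r φ, x, z =>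
      ∀ y : M.carrier, ‖y‖ ≤ ((r : ℚ) : ℝ) → φ.Realize M (Matrix.vecCons y x) z
  | _, _, .exS r φ, x, z =>
      ∃ c : ℂ, ‖c‖ ≤ ((r : ℚ) : ℝ) ∧ φ.Realize M x (Matrix.vecCons c z)
  | _, _, .allS r φ, x, z =>
      ∀ c : ℂ, ‖c‖ ≤ ((r : ℚ) : ℝ) → φ.Realize M x (Matrix.vecCons c z)

/-- `Approx φ φ'`: the formula `φ'` is an approximation of `φ`. -/
inductive Formula.Approx {G : Type u} : {m n : ℕ} → Formula G m n → Formula G m n → Prop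
  | le {m n : ℕ} {t : Term G m n .scal} {p p' : ℚ} (h : p < p') :
      Formula.Approx (.le t p) (.le t p')
  | ge {m n : ℕ} {t : Term G m n .scal} {p p' : ℚ} (h : p' < p) :
      Formula.Approx (.ge t p) (.ge t p')
  | and {m n : ℕ} {φ φ' ψ ψ' : Formula G m n} (h : Formula.Approx φ φ')
      (h' : Formula.Approx ψ ψ') : Formula.Approx (.and φ ψ) (.and φ' ψ')
  | or {m n : ℕ} {φ φ' ψ ψ' : Formula G m n} (h : Formula.Approx φ φ')
      (h' : Formula.Approx ψ ψ') : Formula.Approx (.or φ ψ) (.or φ' ψ')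
  | exV {m n : ℕ} {r r' : PosRat} {φ φ' : Formula G (m + 1) n} (hr : r < r')
      (h : Formula.Approx φ φ') : Formula.Approx (.exV r φ) (.exV r' φ')
  | allV {m n : ℕ} {r r' : PosRat} {φ φ' : Formula G (m + 1) n} (hr : r' < r)
      (h : Formula.Approx φ φ') : Formula.Approx (.allV r φ) (.allV r' φ')
  | exS {m n : ℕ} {r r' : PosRat} {φ φ' : Formula G m (n + 1)} (hr : r < r')
      (h : Formula.Approx φ φ') : Formula.Approx (.exS r φ) (.exS r' φ')
  | allS {m n : ℕ} {r r' : PosRat} {φ φ' : Formula G m (n + 1)} (hr : r' < r)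
      (h : Formula.Approx φ φ') : Formula.Approx (.allS r φ) (.allS r' φ')

/-- Approximate satisfaction: every approximation is satisfied. -/
def Formula.ApproxRealize {G : Type u} {m n : ℕ} (M : LGStructure.{u, v} G) (φ : Formula G m n)
    (x : Fin m → M.carrier) (z : Fin n → ℂ) : Prop :=
  ∀ φ' : Formula G m n, φ.Approx φ' → φ'.Realize M x z

/-- Quantifier-free formulas. -/
inductive Formula.IsQF {G : Type u} : {m n : ℕ} → Formula G m n → Prop
  | le {m n : ℕ} (t : Term G m n .scal) (p : ℚ) : Formula.IsQF (.le t p)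
  | ge {m n : ℕ} (t : Term G m n .scal) (p : ℚ) : Formula.IsQF (.ge t p)
  | and {m n : ℕ} {φ ψ : Formula G m n} (h : Formula.IsQF φ) (h' : Formula.IsQF ψ) :
      Formula.IsQF (.and φ ψ)
  | or {m n : ℕ} {φ ψ : Formula G m n} (h : Formula.IsQF φ) (h' : Formula.IsQF ψ) :
      Formula.IsQF (.or φ ψ)

/-- Existential formulas: a block of bounded existential quantifiers before a quantifier-free
formula. -/
inductive Formula.IsExistential {G : Type u} : {m n : ℕ} → Formula G m n → Prop
  | qf {m n : ℕ} {φ : Formula G m n} (h : φ.IsQF) : Formula.IsExistential φ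
  | exV {m n : ℕ} (r : PosRat) {φ : Formula G (m + 1) n} (h : Formula.IsExistential φ) :
      Formula.IsExistential (.exV r φ)
  | exS {m n : ℕ} (r : PosRat) {φ : Formula G m (n + 1)} (h : Formula.IsExistential φ) :
      Formula.IsExistential (.exS r φ)

/-! ### Theories -/

/-- Sentences of `L_G`. -/
abbrev Sentence (G : Type u) : Type u := Formula G 0 0

/-- Theories: sets of positive bounded sentences. -/
abbrev Theory (G : Type u) : Type u := Set (Sentence G)

/-- `M ⊨ σ`. -/
def Satisfies {G : Type u} (M : LGStructure.{u, v} G) (σ : Sentence G) : Prop :=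
  σ.Realize M ![] ![]

/-- `M ⊨_A σ`. -/
def ApproxSatisfies {G : Type u} (M : LGStructure.{u, v} G) (σ : Sentence G) : Prop :=
  σ.ApproxRealize M ![] ![]

/-- `M` is a model of `T`, in the sense of approximate satisfaction. -/
def IsModel {G : Type u} (M : LGStructure.{u, v} G) (T : Theory G) : Prop :=
  ∀ σ ∈ T, ApproxSatisfies M σ

/-- The approximate theory `Th_A(M)`. -/
def approxTheory {G : Type u} (M : LGStructure.{u, v} G) : Theory G :=
  {σ | ApproxSatisfies M σ}

/-- The formula `s = t` for vector terms, written `‖s + (-1) t‖ ≤ 0`. -/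
def eqV {G : Type u} {m n : ℕ} (s t : Term G m n .vec) : Formula G m n :=
  .le (.snorm (.vadd s (.vsmul (.srat (-1)) t))) 0

/-- The formula `a = b` for scalar terms, written `|a + (-1) b|² ≤ 0`. -/
def eqS {G : Type u} {m n : ℕ} (a b : Term G m n .scal) : Formula G m n :=
  .le (.smul (.sadd a (.smul (.srat (-1)) b)) (.sconj (.sadd a (.smul (.srat (-1)) b)))) 0

/-- The axioms of Hilbert spaces: `⟨,⟩` is an inner product (linear in the second argument) that
induces the norm. Each axiom is the family of its restrictions to balls of rational radius. -/
inductive theoryHilbert (G : Type u) : Sentence G → Prop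
  | inner_add (r : PosRat) : theoryHilbert G
      (.allV r (.allV r (.allV r (eqS (.sinner (.vvar 0) (.vadd (.vvar 1) (.vvar 2)))
        (.sadd (.sinner (.vvar 0) (.vvar 1)) (.sinner (.vvar 0) (.vvar 2)))))))
  | inner_smul (r : PosRat) : theoryHilbert G
      (.allV r (.allV r (.allS r (eqS (.sinner (.vvar 0) (.vsmul (.svar 0) (.vvar 1)))
        (.smul (.svar 0) (.sinner (.vvar 0) (.vvar 1)))))))
  | inner_conj (r : PosRat) : theoryHilbert G
      (.allV r (.allV r (eqS (.sconj (.sinner (.vvar 0) (.vvar 1)))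
        (.sinner (.vvar 1) (.vvar 0)))))
  | inner_self (r : PosRat) : theoryHilbert G
      (.allV r (eqS (.sinner (.vvar 0) (.vvar 0))
        (.smul (.snorm (.vvar 0)) (.snorm (.vvar 0)))))

/-- The axioms stating that each `τ_g` is an automorphism of the Hilbert space and that
`g ↦ τ_g` is a representation of `G` (so that `τ_g` is invertible with inverse `τ_{g⁻¹}`). -/
inductive theoryAction (G : Type u) [Group G] : Sentence G → Prop
  | act_add (g : G) (r : PosRat) : theoryAction G
      (.allV r (.allV r (eqV (.vact g (.vadd (.vvar 0) (.vvar 1)))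
        (.vadd (.vact g (.vvar 0)) (.vact g (.vvar 1))))))
  | act_smul (g : G) (r : PosRat) : theoryAction G
      (.allV r (.allS r (eqV (.vact g (.vsmul (.svar 0) (.vvar 0)))
        (.vsmul (.svar 0) (.vact g (.vvar 0))))))
  | act_inner (g : G) (r : PosRat) : theoryAction G
      (.allV r (.allV r (eqS (.sinner (.vact g (.vvar 0)) (.vact g (.vvar 1)))
        (.sinner (.vvar 0) (.vvar 1)))))
  | act_mul (g h : G) (r : PosRat) : theoryAction G
      (.allV r (eqV (.vact (g * h) (.vvar 0)) (.vact g (.vact h (.vvar 0)))))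
  | act_one (r : PosRat) : theoryAction G
      (.allV r (eqV (.vact 1 (.vvar 0)) (.vvar 0)))

/-- The theory `T_G` of Hilbert spaces with a unitary representation of `G`. -/
def theoryTG (G : Type u) [Group G] : Theory G :=
  {σ | theoryHilbert G σ ∨ theoryAction G σ}

/-- The theory `T_GA = Th_A(H_{∞λ_G}, +, ⟨,⟩, ∞λ_G)`. -/
def theoryTGA (G : Type u) [Group G] : Theory G := approxTheory (inftyRegular G)

/-- `Σ_G`: the existential sentences true in `(H_{∞λ_G}, +, ⟨,⟩, ∞λ_G)`. -/
def sigmaG (G : Type u) [Group G] : Theory G :=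
  {σ | σ.IsExistential ∧ Satisfies (inftyRegular G) σ}

/-- `Σ_G⁻`: the approximations of the sentences of `Σ_G`. -/
def sigmaGMinus (G : Type u) [Group G] : Theory G :=
  {σ' | ∃ σ ∈ sigmaG G, σ.Approx σ'}

/-! ### Quantifier elimination, axiomatizations, model companions -/

/-- `Γ` axiomatizes `T`: the two theories have the same models. -/
def Axiomatizes {G : Type u} (Γ T : Theory G) : Prop :=
  ∀ M : LGStructure.{u, v} G, IsModel M T ↔ IsModel M Γ

/-- Quantifier elimination for approximate theories: for every formula `φ` with an approximation
`φ'` and every bound `R` on the free variables there are a quantifier-free formula `ψ` and an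
approximation `ψ'` of it such that `φ → ψ` and `ψ' → φ'` hold in all models of `T` for all tuples
bounded by `R`. -/
def HasQE {G : Type u} (T : Theory G) : Prop :=
  ∀ (m n : ℕ) (φ φ' : Formula G m n), φ.Approx φ' → ∀ R : PosRat,
    ∃ ψ ψ' : Formula G m n, ψ.IsQF ∧ ψ.Approx ψ' ∧
      ∀ M : LGStructure.{u, v} G, IsModel M T →
        ∀ (x : Fin m → M.carrier) (z : Fin n → ℂ),
          (∀ i, ‖x i‖ ≤ ((R : ℚ) : ℝ)) → (∀ j, ‖z j‖ ≤ ((R : ℚ) : ℝ)) →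
            (φ.Realize M x z → ψ.Realize M x z) ∧ (ψ'.Realize M x z → φ'.Realize M x z)

/-- Embeddings of structures: linear isometries that preserve `⟨,⟩` and commute with the `τ_g`. -/
structure Embedding {G : Type u} (M : LGStructure.{u, v} G) (N : LGStructure.{u, w} G) where
  toLinearIsometry : M.carrier →ₗᵢ[ℂ] N.carrier
  map_ip : ∀ x y, N.ip (toLinearIsometry x) (toLinearIsometry y) = M.ip x y
  map_act : ∀ g x, toLinearIsometry (M.act g x) = N.act g (toLinearIsometry x)

/-- An embedding is approximately elementary if it preserves and reflects approximate satisfaction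
of all positive bounded formulas. -/
def Embedding.IsApproxElementary {G : Type u} {M : LGStructure.{u, v} G}
    {N : LGStructure.{u, w} G} (f : Embedding M N) : Prop :=
  ∀ (m n : ℕ) (φ : Formula G m n) (x : Fin m → M.carrier) (z : Fin n → ℂ),
    φ.ApproxRealize M x z ↔ φ.ApproxRealize N (fun i => f.toLinearIsometry (x i)) z

/-- A theory is model complete if all embeddings between its models are approximately
elementary. -/
def IsModelComplete {G : Type u} (T : Theory G) : Prop :=
  ∀ M N : LGStructure.{u, v} G, IsModel M T → IsModel N T →
    ∀ f : Embedding M N, f.IsApproxElementary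

/-- `T'` is a model companion of `T`: it is model complete, every model of `T` embeds in a model
of `T'` and every model of `T'` embeds in a model of `T`. -/
def IsModelCompanion {G : Type u} (T' T : Theory G) : Prop :=
  IsModelComplete.{u, v} T' ∧
  (∀ M : LGStructure.{u, v} G, IsModel M T →
    ∃ N : LGStructure.{u, max u v} G, IsModel N T' ∧ Nonempty (Embedding M N)) ∧
  (∀ M : LGStructure.{u, v} G, IsModel M T' →
    ∃ N : LGStructure.{u, max u v} G, IsModel N T ∧ Nonempty (Embedding M N))

end HilbRep

end

-- The value of a term at a tuple x of a unitary representation is a continuous function of the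
-- scalar variables and of the coefficients ⟨x_i, g x_j⟩, so these numbers are the whole
-- quantifier-free type. Everything follows from one transfer principle, `exists_transfers`: if φ'
-- approximates φ, then a finite F ⊆ G and δ > 0 exist such that, for bounded tuples in any two
-- models of T_G ∪ Σ_G⁻ whose types agree on F up to δ, φ at one tuple implies φ' at the other. With
-- no free variables this gives the axiomatization; for equal types it gives model completeness;
-- with a finite cover of the compact set of bounded types it gives quantifier elimination.
--
-- Transfer is a back-and-forth with errors, and its quantifier step is `exists_extension`. A new
-- vector c is split as v + e, where v is built from translates of x in a bounded number of steps
-- and e is almost orthogonal to the relevant translates of v and x. The same steps applied to the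
-- other tuple y give a counterpart w of v. It remains to find a vector e' with almost the
-- coefficients of e and almost orthogonal to the translates of w and y (`exists_approx_copy`).
--
-- Amenability enters here. Almost invariant vectors ξ of λ_G, combined with Fell absorption (λ ⊗ π
-- is a multiple of λ), show that ∞λ_G contains orthogonal families of approximate copies of any
-- vector of any representation (`IsAmenable.exists_orthogonal_copies`). Existential sentences
-- express this, so it holds in every model of Σ_G⁻; by Bessel's inequality one member of a long
-- enough family is almost orthogonal to any given finite set.
--
-- Finally, adding ∞λ_G as a direct summand embeds any representation in a model of T_GA.

noncomputable section

namespace HilbRep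

/-! ### Values of terms -/

section Terms

variable {G : Type u} {m n : ℕ} (M : LGStructure.{u, v} G) (x : Fin m → M.carrier) (z : Fin n → ℂ)

/-- The value of a vector term. -/
def Term.vector (t : Term G m n .vec) : M.carrier := t.eval M x z

@[simp] theorem Term.vector_vvar (i : Fin m) :
    (Term.vvar i : Term G m n .vec).vector M x z = x i := rfl
@[simp] theorem Term.vector_vzero : (Term.vzero : Term G m n .vec).vector M x z = 0 := rfl
@[simp] theorem Term.vector_vadd (s t : Term G m n .vec) :
    (Term.vadd s t).vector M x z = s.vector M x z + t.vector M x z := rfl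
@[simp] theorem Term.vector_vsmul (a : Term G m n .scal) (s : Term G m n .vec) :
    (Term.vsmul a s).vector M x z = a.scalar M x z • s.vector M x z := rfl
@[simp] theorem Term.vector_vact (g : G) (s : Term G m n .vec) :
    (Term.vact g s).vector M x z = M.act g (s.vector M x z) := rfl
@[simp] theorem Term.scalar_svar (j : Fin n) :
    (Term.svar j : Term G m n .scal).scalar M x z = z j := rfl
@[simp] theorem Term.scalar_srat (q : ℚ) :
    (Term.srat q : Term G m n .scal).scalar M x z = (q : ℂ) := rfl
@[simp] theorem Term.scalar_simag :
    (Term.simag : Term G m n .scal).scalar M x z = Complex.I := rfl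
@[simp] theorem Term.scalar_sadd (a b : Term G m n .scal) :
    (Term.sadd a b).scalar M x z = a.scalar M x z + b.scalar M x z := rfl
@[simp] theorem Term.scalar_smul (a b : Term G m n .scal) :
    (Term.smul a b).scalar M x z = a.scalar M x z * b.scalar M x z := rfl
@[simp] theorem Term.scalar_sconj (a : Term G m n .scal) :
    (Term.sconj a).scalar M x z = star (a.scalar M x z) := rfl
@[simp] theorem Term.scalar_sinner (s t : Term G m n .vec) :
    (Term.sinner s t).scalar M x z = M.ip (s.vector M x z) (t.vector M x z) := rfl
@[simp] theorem Term.scalar_snorm (s : Term G m n .vec) :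
    (Term.snorm s).scalar M x z = ((‖s.vector M x z‖ : ℝ) : ℂ) := rfl

/-- The scalar term `|a - b|²`. -/
def Term.distSq (a b : Term G m n .scal) : Term G m n .scal :=
  .smul (.sadd a (.smul (.srat (-1)) b)) (.sconj (.sadd a (.smul (.srat (-1)) b)))

theorem Term.re_scalar_distSq (a b : Term G m n .scal) :
    ((a.distSq b).scalar M x z).re = ‖a.scalar M x z - b.scalar M x z‖ ^ 2 := by
  simp only [Term.distSq, Term.scalar_smul, Term.scalar_sconj, Term.scalar_sadd,
    Term.scalar_srat, Rat.cast_neg, Rat.cast_one, neg_mul, one_mul, ← sub_eq_add_neg]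
  rw [Complex.star_def, Complex.mul_conj, Complex.ofReal_re, Complex.normSq_eq_norm_sq]

theorem realize_eqS (a b : Term G m n .scal) :
    (eqS a b).Realize M x z ↔ a.scalar M x z = b.scalar M x z := by
  change ((a.distSq b).scalar M x z).re ≤ ((0 : ℚ) : ℝ) ↔ _
  rw [Term.re_scalar_distSq, Rat.cast_zero, sq_nonpos_iff, norm_eq_zero, sub_eq_zero]

theorem realize_eqV (s t : Term G m n .vec) :
    (eqV s t).Realize M x z ↔ s.vector M x z = t.vector M x z := by
  change ((Term.snorm (.vadd s (.vsmul (.srat (-1)) t))).scalar M x z).re ≤ ((0 : ℚ) : ℝ) ↔ _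
  simp [← sub_eq_add_neg, sub_eq_zero]

end Terms

/-! ### Approximations -/

section Approximations

variable {G : Type u} {M : LGStructure.{u, v} G}

theorem Formula.Approx.realize {m n : ℕ} {φ φ' : Formula G m n} (h : φ.Approx φ')
    {x : Fin m → M.carrier} {z : Fin n → ℂ} (hx : φ.Realize M x z) : φ'.Realize M x z := by
  induction h with
  | le h =>
    exact le_trans (show _ ≤ _ from hx) (by exact_mod_cast h.le)
  | ge h =>
    exact le_trans (by exact_mod_cast h.le) (show _ ≤ _ from hx)
  | and _ _ ih ih' => exact ⟨ih hx.1, ih' hx.2⟩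
  | or _ _ ih ih' => exact hx.imp ih ih'
  | exV hr _ ih =>
    obtain ⟨y, hy, h⟩ := hx
    exact ⟨y, hy.trans (by exact_mod_cast hr.le), ih h⟩
  | allV hr _ ih =>
    exact fun y hy => ih (hx y (hy.trans (by exact_mod_cast hr.le)))
  | exS hr _ ih =>
    obtain ⟨y, hy, h⟩ := hx
    exact ⟨y, hy.trans (by exact_mod_cast hr.le), ih h⟩
  | allS hr _ ih =>
    exact fun y hy => ih (hx y (hy.trans (by exact_mod_cast hr.le)))

theorem Formula.Realize.approxRealize {m n : ℕ} {φ : Formula G m n}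
    {x : Fin m → M.carrier} {z : Fin n → ℂ} (hx : φ.Realize M x z) : φ.ApproxRealize M x z :=
  fun _ h => h.realize hx

theorem PosRat.exists_between {r r' : PosRat} (h : r < r') : ∃ s : PosRat, r < s ∧ s < r' := by
  obtain ⟨s, hs, hs'⟩ := _root_.exists_between (show (r : ℚ) < r' from h)
  exact ⟨⟨s, r.2.trans hs⟩, hs, hs'⟩

/-- Density of ℚ. Approximate satisfaction of φ gives honest satisfaction of the intermediate
formula, and the remaining gap up to φ' absorbs the errors of a transfer. -/
theorem Formula.Approx.exists_between {m n : ℕ} {φ φ' : Formula G m n} (h : φ.Approx φ') :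
    ∃ ψ, φ.Approx ψ ∧ ψ.Approx φ' := by
  induction h with
  | le h => obtain ⟨q, h1, h2⟩ := _root_.exists_between h; exact ⟨_, .le h1, .le h2⟩
  | ge h => obtain ⟨q, h1, h2⟩ := _root_.exists_between h; exact ⟨_, .ge h2, .ge h1⟩
  | and _ _ ih ih' =>
    obtain ⟨_, h1, h2⟩ := ih; obtain ⟨_, h3, h4⟩ := ih'
    exact ⟨_, .and h1 h3, .and h2 h4⟩
  | or _ _ ih ih' =>
    obtain ⟨_, h1, h2⟩ := ih; obtain ⟨_, h3, h4⟩ := ih'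
    exact ⟨_, .or h1 h3, .or h2 h4⟩
  | exV hr _ ih =>
    obtain ⟨_, h1, h2⟩ := ih; obtain ⟨_, h3, h4⟩ := PosRat.exists_between hr
    exact ⟨_, .exV h3 h1, .exV h4 h2⟩
  | allV hr _ ih =>
    obtain ⟨_, h1, h2⟩ := ih; obtain ⟨_, h3, h4⟩ := PosRat.exists_between hr
    exact ⟨_, .allV h4 h1, .allV h3 h2⟩
  | exS hr _ ih =>
    obtain ⟨_, h1, h2⟩ := ih; obtain ⟨_, h3, h4⟩ := PosRat.exists_between hr
    exact ⟨_, .exS h3 h1, .exS h4 h2⟩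
  | allS hr _ ih =>
    obtain ⟨_, h1, h2⟩ := ih; obtain ⟨_, h3, h4⟩ := PosRat.exists_between hr
    exact ⟨_, .allS h4 h1, .allS h3 h2⟩

theorem PosRat.exists_btwn {a : ℝ} (ha : 0 ≤ a) {r : PosRat} (h : a < ((r : ℚ) : ℝ)) :
    ∃ s : PosRat, a ≤ ((s : ℚ) : ℝ) ∧ s < r := by
  obtain ⟨q, hq, hq'⟩ := exists_rat_btwn h
  exact ⟨⟨q, by exact_mod_cast ha.trans_lt hq⟩, hq.le, by exact_mod_cast hq'⟩

theorem PosRat.exists_gt (a : ℝ) : ∃ s : PosRat, a < ((s : ℚ) : ℝ) := by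
  obtain ⟨q, hq⟩ := exists_rat_gt (max a 0)
  exact ⟨⟨q, by exact_mod_cast (le_max_right a 0).trans_lt hq⟩, (le_max_left a 0).trans_lt hq⟩

/-- Approximating shrinks the bound of a universal quantifier, so only points strictly inside the
ball are reached. This loses nothing for axioms that are given at every radius. -/
theorem Formula.ApproxRealize.of_allV {m n : ℕ} {r : PosRat} {φ : Formula G (m + 1) n}
    {x : Fin m → M.carrier} {z : Fin n → ℂ} (h : (Formula.allV r φ).ApproxRealize M x z)
    (y : M.carrier) (hy : ‖y‖ < ((r : ℚ) : ℝ)) : φ.ApproxRealize M (Matrix.vecCons y x) z := by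
  intro φ' hφ'
  obtain ⟨s, hs, hsr⟩ := PosRat.exists_btwn (norm_nonneg y) hy
  exact h _ (.allV hsr hφ') y hs

theorem Formula.ApproxRealize.of_allS {m n : ℕ} {r : PosRat} {φ : Formula G m (n + 1)}
    {x : Fin m → M.carrier} {z : Fin n → ℂ} (h : (Formula.allS r φ).ApproxRealize M x z)
    (y : ℂ) (hy : ‖y‖ < ((r : ℚ) : ℝ)) : φ.ApproxRealize M x (Matrix.vecCons y z) := by
  intro φ' hφ'
  obtain ⟨s, hs, hsr⟩ := PosRat.exists_btwn (norm_nonneg y) hy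
  exact h _ (.allS hsr hφ') y hs

/-- A real number below every rational p' > p is at most p. Hence the equational axioms of T_G hold
exactly in its approximate models. -/
theorem Formula.ApproxRealize.realize_le {m n : ℕ} {t : Term G m n .scal} {p : ℚ}
    {x : Fin m → M.carrier} {z : Fin n → ℂ} (h : (Formula.le t p).ApproxRealize M x z) :
    (Formula.le t p).Realize M x z := by
  refine le_of_forall_gt fun b hb => ?_
  obtain ⟨q, hq, hq'⟩ := exists_rat_btwn hb
  exact lt_of_le_of_lt (h _ (.le (by exact_mod_cast hq))) hq'

theorem Formula.ApproxRealize.eqS {m n : ℕ} {a b : Term G m n .scal}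
    {x : Fin m → M.carrier} {z : Fin n → ℂ} (h : (eqS a b).ApproxRealize M x z) :
    a.scalar M x z = b.scalar M x z :=
  (realize_eqS M x z a b).1 h.realize_le

theorem Formula.ApproxRealize.eqV {m n : ℕ} {s t : Term G m n .vec}
    {x : Fin m → M.carrier} {z : Fin n → ℂ} (h : (eqV s t).ApproxRealize M x z) :
    s.vector M x z = t.vector M x z :=
  (realize_eqV M x z s t).1 h.realize_le

end Approximations

/-! ### Models of `T_G` are unitary representations -/

section ModelsTG

variable {G : Type u} [Group G]

theorem isModel_theoryTG_ofRep {H : Type v} [NormedAddCommGroup H] [InnerProductSpace ℂ H]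
    [CompleteSpace H] (π : UnitaryRep G H) : IsModel (ofRep π) (theoryTG G) := by
  rintro σ (hσ | hσ)
  · cases hσ with
    | inner_add r =>
      refine Formula.Realize.approxRealize fun x _ y _ w _ => (realize_eqS _ _ _ _ _).2 ?_
      simp
    | inner_smul r =>
      refine Formula.Realize.approxRealize fun x _ y _ w _ => (realize_eqS _ _ _ _ _).2 ?_
      simp
    | inner_conj r =>
      refine Formula.Realize.approxRealize fun x _ y _ => (realize_eqS _ _ _ _ _).2 ?_
      simp
    | inner_self r =>
      refine Formula.Realize.approxRealize fun x _ => (realize_eqS _ _ _ _ _).2 ?_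
      simp [inner_self_eq_norm_sq_to_K, sq]
  · cases hσ with
    | act_add g r =>
      refine Formula.Realize.approxRealize fun x _ y _ => (realize_eqV _ _ _ _ _).2 ?_
      simp
    | act_smul g r =>
      refine Formula.Realize.approxRealize fun x _ y _ => (realize_eqV _ _ _ _ _).2 ?_
      simp
    | act_inner g r =>
      refine Formula.Realize.approxRealize fun x _ y _ => (realize_eqS _ _ _ _ _).2 ?_
      simp
    | act_mul g h r =>
      refine Formula.Realize.approxRealize fun x _ => (realize_eqV _ _ _ _ _).2 ?_
      simp
    | act_one r =>
      refine Formula.Realize.approxRealize fun x _ => (realize_eqV _ _ _ _ _).2 ?_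
      simp

theorem exists_eq_ofRep {M : LGStructure.{u, v} G} (hM : IsModel M (theoryTG G)) :
    ∃ (H : Type v) (_ : NormedAddCommGroup H) (_ : InnerProductSpace ℂ H) (_ : CompleteSpace H)
      (π : UnitaryRep G H), M = ofRep π := by
  have ip_add : ∀ x y w, M.ip x (y + w) = M.ip x y + M.ip x w := by
    intro x y w
    obtain ⟨r, hr⟩ := PosRat.exists_gt (max ‖x‖ (max ‖y‖ ‖w‖))
    simp only [max_lt_iff] at hr
    -- The outermost quantifier ends up with the highest index, so the last variable is instantiated
    -- first.
    exact ((((hM _ (.inl (.inner_add r))).of_allV w hr.2.2).of_allV y hr.2.1).of_allV x hr.1).eqS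
  have ip_smul : ∀ (c : ℂ) x y, M.ip x (c • y) = c * M.ip x y := by
    intro c x y
    obtain ⟨r, hr⟩ := PosRat.exists_gt (max ‖x‖ (max ‖y‖ ‖c‖))
    simp only [max_lt_iff] at hr
    exact ((((hM _ (.inl (.inner_smul r))).of_allV y hr.2.1).of_allV x hr.1).of_allS c hr.2.2).eqS
  have ip_conj : ∀ x y, star (M.ip x y) = M.ip y x := by
    intro x y
    obtain ⟨r, hr⟩ := PosRat.exists_gt (max ‖x‖ ‖y‖)
    simp only [max_lt_iff] at hr
    exact (((hM _ (.inl (.inner_conj r))).of_allV y hr.2).of_allV x hr.1).eqS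
  have ip_self : ∀ x, M.ip x x = (‖x‖ : ℂ) * ‖x‖ := by
    intro x
    obtain ⟨r, hr⟩ := PosRat.exists_gt ‖x‖
    exact ((hM _ (.inl (.inner_self r))).of_allV x hr).eqS
  have act_add : ∀ g x y, M.act g (x + y) = M.act g x + M.act g y := by
    intro g x y
    obtain ⟨r, hr⟩ := PosRat.exists_gt (max ‖x‖ ‖y‖)
    simp only [max_lt_iff] at hr
    exact (((hM _ (.inr (.act_add g r))).of_allV y hr.2).of_allV x hr.1).eqV
  have act_smul : ∀ g (c : ℂ) x, M.act g (c • x) = c • M.act g x := by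
    intro g c x
    obtain ⟨r, hr⟩ := PosRat.exists_gt (max ‖x‖ ‖c‖)
    simp only [max_lt_iff] at hr
    exact (((hM _ (.inr (.act_smul g r))).of_allV x hr.1).of_allS c hr.2).eqV
  have act_inner : ∀ g x y, M.ip (M.act g x) (M.act g y) = M.ip x y := by
    intro g x y
    obtain ⟨r, hr⟩ := PosRat.exists_gt (max ‖x‖ ‖y‖)
    simp only [max_lt_iff] at hr
    exact (((hM _ (.inr (.act_inner g r))).of_allV y hr.2).of_allV x hr.1).eqS
  have act_mul : ∀ g h x, M.act (g * h) x = M.act g (M.act h x) := by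
    intro g h x
    obtain ⟨r, hr⟩ := PosRat.exists_gt ‖x‖
    exact ((hM _ (.inr (.act_mul g h r))).of_allV x hr).eqV
  have act_one : ∀ x, M.act 1 x = x := by
    intro x
    obtain ⟨r, hr⟩ := PosRat.exists_gt ‖x‖
    exact ((hM _ (.inr (.act_one r))).of_allV x hr).eqV
  let I : InnerProductSpace ℂ M.carrier :=
    { M.normedSpace with
      inner := M.ip
      norm_sq_eq_re_inner := fun x => by
        simp [ip_self, sq]
      conj_inner_symm := fun x y => ip_conj y x
      add_left := fun x y w => by
        rw [← ip_conj, ip_add, star_add, ip_conj, ip_conj]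
      smul_left := fun x y c => by
        rw [← ip_conj, ip_smul, star_mul', ip_conj]; rfl }
  let U : G → (M.carrier ≃ₗᵢ[ℂ] M.carrier) := fun g =>
    { toFun := M.act g
      invFun := M.act g⁻¹
      map_add' := act_add g
      map_smul' := act_smul g
      left_inv := fun x => by rw [← act_mul, inv_mul_cancel, act_one]
      right_inv := fun x => by rw [← act_mul, mul_inv_cancel, act_one]
      norm_map' := fun x => by
        have h := act_inner g x x
        rw [ip_self, ip_self] at h
        have h' : ‖M.act g x‖ * ‖M.act g x‖ = ‖x‖ * ‖x‖ := by exact_mod_cast h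
        exact (mul_self_inj (norm_nonneg _) (norm_nonneg _)).1 h' }
  refine ⟨M.carrier, M.normedAddCommGroup, I, M.completeSpace,
    { toFun := U, map_one' := ?_, map_mul' := ?_ }, ?_⟩
  · ext x; exact act_one x
  · intro g h; ext x; exact act_mul g h x
  -- The inner product and the operators are those of `M`, and the norm is unchanged, so the two
  -- structures agree by definition.
  · rfl

end ModelsTG

/-! ### Embeddings -/

section Embeddings

variable {G : Type u} {M : LGStructure.{u, v} G} {N : LGStructure.{u, w} G}

/-- Scalar and vector terms contain each other, so a single induction treats both sorts. -/
theorem Embedding.eval_eq (f : Embedding M N) {m n : ℕ} (x : Fin m → M.carrier) (z : Fin n → ℂ)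
    {s : Srt} (t : Term G m n s) :
    match s, t with
    | .vec, t => t.vector N (fun i => f.toLinearIsometry (x i)) z =
        f.toLinearIsometry (t.vector M x z)
    | .scal, t => t.scalar N (fun i => f.toLinearIsometry (x i)) z = t.scalar M x z := by
  induction t with
  | vvar | svar | srat | simag => rfl
  | vzero => simp
  | vadd s t ihs iht => simp_all
  | vsmul a s iha ihs => simp_all
  | vact g s ihs => simp_all [f.map_act]
  | sadd a b iha ihb => simp_all
  | smul a b iha ihb => simp_all
  | sconj a iha => simp_all
  | sinner s t ihs iht => simp_all [f.map_ip]
  | snorm s ihs => simp_all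

theorem Embedding.scalar_eq (f : Embedding M N) {m n : ℕ} (x : Fin m → M.carrier)
    (z : Fin n → ℂ) (t : Term G m n .scal) :
    t.scalar N (fun i => f.toLinearIsometry (x i)) z = t.scalar M x z :=
  f.eval_eq x z t

theorem Embedding.comp_vecCons (f : Embedding M N) {m : ℕ} (y : M.carrier)
    (x : Fin m → M.carrier) :
    (fun i => f.toLinearIsometry ((Matrix.vecCons y x : Fin (m + 1) → M.carrier) i)) =
      Matrix.vecCons (f.toLinearIsometry y) (fun i => f.toLinearIsometry (x i)) := by
  funext i
  refine Fin.cases ?_ (fun i => ?_) i <;> simp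

theorem Embedding.realize_of_isQF (f : Embedding M N) {m n : ℕ} {φ : Formula G m n}
    (hφ : φ.IsQF) {x : Fin m → M.carrier} {z : Fin n → ℂ} (h : φ.Realize M x z) :
    φ.Realize N (fun i => f.toLinearIsometry (x i)) z := by
  induction hφ with
  | le t p => change _ ≤ _; rw [f.scalar_eq]; exact h
  | ge t p => change _ ≤ _; rw [f.scalar_eq]; exact h
  | and _ _ ih ih' => exact ⟨ih h.1, ih' h.2⟩
  | or _ _ ih ih' => exact Or.imp ih ih' h

theorem Embedding.realize_of_isExistential (f : Embedding M N) {m n : ℕ} {φ : Formula G m n}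
    (hφ : φ.IsExistential) {x : Fin m → M.carrier} {z : Fin n → ℂ} (h : φ.Realize M x z) :
    φ.Realize N (fun i => f.toLinearIsometry (x i)) z := by
  induction hφ with
  | qf hφ => exact f.realize_of_isQF hφ h
  | exV r _ ih =>
    obtain ⟨y, hy, h⟩ := h
    refine ⟨f.toLinearIsometry y, by simpa using hy, ?_⟩
    rw [← f.comp_vecCons]
    exact ih h
  | exS r _ ih =>
    obtain ⟨y, hy, h⟩ := h
    exact ⟨y, hy, ih h⟩

end Embeddings

/-! ### Boxes -/

section Boxes

variable {G : Type u} {m n : ℕ}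

/-- The term for a complex number with rational real and imaginary parts. -/
def Term.ofRat (q : ℚ × ℚ) : Term G m n .scal := .sadd (.srat q.1) (.smul (.srat q.2) .simag)

/-- The complex number with given rational real and imaginary parts. -/
def ratComplex (q : ℚ × ℚ) : ℂ := q.1 + q.2 * Complex.I

theorem Term.scalar_ofRat (M : LGStructure.{u, v} G) (x : Fin m → M.carrier) (z : Fin n → ℂ)
    (q : ℚ × ℚ) : (Term.ofRat q : Term G m n .scal).scalar M x z = ratComplex q := rfl

theorem exists_ratComplex_near (c : ℂ) {ε : ℝ} (hε : 0 < ε) :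
    ∃ q, ‖c - ratComplex q‖ < ε := by
  obtain ⟨a, ha⟩ := exists_rat_near c.re (half_pos hε)
  obtain ⟨b, hb⟩ := exists_rat_near c.im (half_pos hε)
  refine ⟨(a, b), (Complex.norm_le_abs_re_add_abs_im _).trans_lt ?_⟩
  simp only [ratComplex, Complex.sub_re, Complex.add_re, Complex.ratCast_re, Complex.mul_re,
    Complex.I_re, Complex.ratCast_im, Complex.I_im, Complex.sub_im, Complex.add_im, Complex.mul_im]
  simp only [mul_zero, mul_one, sub_zero, add_zero, zero_add]
  linarith

/-- The conjunction of the conditions `|t - q|² ≤ η` for the pairs `(t, q)` of a list. -/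
def boxFormula (η : ℚ) : List (Term G m n .scal × (ℚ × ℚ)) → Formula G m n
  | [] => .le (.srat 0) η
  | p :: l => .and (.le (p.1.distSq (.ofRat p.2)) η) (boxFormula η l)

theorem boxFormula_isQF (η : ℚ) (l : List (Term G m n .scal × (ℚ × ℚ))) :
    (boxFormula η l).IsQF := by
  induction l with
  | nil => exact .le _ _
  | cons p l ih => exact .and (.le _ _) ih

theorem boxFormula_approx {η η' : ℚ} (h : η < η') (l : List (Term G m n .scal × (ℚ × ℚ))) :
    (boxFormula η l).Approx (boxFormula η' l) := by
  induction l with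
  | nil => exact .le h
  | cons p l ih => exact .and (.le h) ih

theorem realize_boxFormula {η : ℚ} (hη : 0 ≤ η) (l : List (Term G m n .scal × (ℚ × ℚ)))
    (M : LGStructure.{u, v} G) (x : Fin m → M.carrier) (z : Fin n → ℂ) :
    (boxFormula η l).Realize M x z ↔
      ∀ p ∈ l, ‖p.1.scalar M x z - ratComplex p.2‖ ^ 2 ≤ (η : ℝ) := by
  induction l with
  | nil =>
    simp only [List.not_mem_nil, false_implies, implies_true, iff_true]
    change (((0 : ℚ) : ℂ)).re ≤ (η : ℝ)
    simpa using hη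
  | cons p l ih =>
    rw [List.forall_mem_cons, ← ih]
    change ((p.1.distSq (.ofRat p.2)).scalar M x z).re ≤ (η : ℝ) ∧ _ ↔ _
    rw [Term.re_scalar_distSq, Term.scalar_ofRat]

/-- The disjunction of a list of formulas. -/
def disjunction : List (Formula G m n) → Formula G m n
  | [] => .le (.srat 1) 0
  | φ :: l => .or φ (disjunction l)

theorem disjunction_isQF {l : List (Formula G m n)} (h : ∀ φ ∈ l, φ.IsQF) :
    (disjunction l).IsQF := by
  induction l with
  | nil => exact .le _ _
  | cons p l ih =>
    rw [List.forall_mem_cons] at h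
    exact .or h.1 (ih h.2)

theorem realize_disjunction {l : List (Formula G m n)} {φ : Formula G m n} (hφ : φ ∈ l)
    {M : LGStructure.{u, v} G} {x : Fin m → M.carrier} {z : Fin n → ℂ} (h : φ.Realize M x z) :
    (disjunction l).Realize M x z := by
  induction l with
  | nil => simp at hφ
  | cons p l ih =>
    rcases List.mem_cons.1 hφ with rfl | hφ
    · exact Or.inl h
    · exact Or.inr (ih hφ)

/-- Approximations of the members of a finite disjunction give an approximation of the
disjunction that is satisfied only if one of them is. -/
theorem exists_approx_disjunction {ι : Type w} (l : List ι) {φ φ' : ι → Formula G m n}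
    (h : ∀ i, (φ i).Approx (φ' i)) :
    ∃ ψ', (disjunction (l.map φ)).Approx ψ' ∧
      ∀ (M : LGStructure.{u, v} G) (x : Fin m → M.carrier) (z : Fin n → ℂ),
        ψ'.Realize M x z → ∃ i ∈ l, (φ' i).Realize M x z := by
  induction l with
  | nil =>
    -- The empty disjunction is the false condition 1 ≤ 0; its relaxation 1 ≤ 1/2 is still false.
    refine ⟨.le (.srat 1) (1 / 2), .le (by norm_num), fun M x z hx => ?_⟩
    change (((1 : ℚ) : ℂ)).re ≤ ((1 / 2 : ℚ) : ℝ) at hx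
    norm_num at hx
  | cons i l ih =>
    obtain ⟨ψ', hψ', H⟩ := ih
    refine ⟨.or (φ' i) ψ', .or (h i) hψ', fun M x z hx => ?_⟩
    rcases hx with hx | hx
    · exact ⟨i, by simp, hx⟩
    · obtain ⟨j, hj, hx⟩ := H M x z hx
      exact ⟨j, by simp [hj], hx⟩

end Boxes

/-! ### Blocks of existential quantifiers -/

section Blocks

variable {G : Type u}

/-- The existential closure of a formula with `m` vector variables, with all quantifiers bounded
by `r`. -/
def exBlock (r : PosRat) : {m : ℕ} → Formula G m 0 → Sentence G
  | 0, φ => φ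
  | _ + 1, φ => exBlock r (.exV r φ)

theorem exBlock_approx {r r' : PosRat} (hr : r < r') {m : ℕ} {φ φ' : Formula G m 0}
    (h : φ.Approx φ') : (exBlock r φ).Approx (exBlock r' φ') := by
  induction m with
  | zero => exact h
  | succ m ih => exact ih (.exV hr h)

theorem exBlock_isExistential (r : PosRat) {m : ℕ} {φ : Formula G m 0} (h : φ.IsExistential) :
    (exBlock r φ).IsExistential := by
  induction m with
  | zero => exact h
  | succ m ih => exact ih (.exV r h)

theorem satisfies_exBlock (M : LGStructure.{u, v} G) (r : PosRat) {m : ℕ} (φ : Formula G m 0) :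
    Satisfies M (exBlock r φ) ↔
      ∃ x : Fin m → M.carrier, (∀ i, ‖x i‖ ≤ ((r : ℚ) : ℝ)) ∧ φ.Realize M x ![] := by
  induction m with
  | zero =>
    constructor
    · exact fun h => ⟨![], fun i => i.elim0, h⟩
    · rintro ⟨x, -, h⟩
      rwa [Subsingleton.elim x ![]] at h
  | succ m ih =>
    refine (ih _).trans ⟨?_, ?_⟩
    · rintro ⟨x, hx, y, hy, h⟩
      refine ⟨Matrix.vecCons y x, fun i => ?_, h⟩
      refine Fin.cases ?_ (fun i => ?_) i
      · simpa using hy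
      · simpa using hx i
    · rintro ⟨x, hx, h⟩
      refine ⟨Matrix.vecTail x, fun i => hx _, Matrix.vecHead x, hx _, ?_⟩
      rwa [Matrix.cons_head_tail]

end Blocks

/-! ### Almost invariant vectors in the regular representation -/

section Amenable

open scoped Classical in
/-- The differences `δ_{gh} - δ_h` in `ℓ¹(G)`, for `g` in a finite set. -/
def shiftDifference {G : Type u} [Group G] (F : Finset G) (h : G) : F → lp (fun _ : G => ℝ) 1 :=
  fun g => lp.single 1 (g * h) 1 - lp.single 1 h 1

/-- The g-component is the translate of f by g minus f, so its ℓ¹-norm is the defect of invariance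
of f under g. -/
theorem linearCombination_shiftDifference_apply {G : Type u} [Group G] (F : Finset G)
    (f : G →₀ ℝ) (g : F) (k : G) :
    Finsupp.linearCombination ℝ (shiftDifference F) f g k = f ((g : G)⁻¹ * k) - f k := by
  classical
  induction f using Finsupp.induction_linear with
  | zero => simp
  | add f f' h h' =>
    rw [map_add, Pi.add_apply, lp.coeFn_add, Pi.add_apply, h, h', Finsupp.add_apply,
      Finsupp.add_apply]
    ring
  | single h c =>
    have h1 : (c • shiftDifference F h) g k =
        c * ((Pi.single (g * h : G) 1 : G → ℝ) k - (Pi.single h 1 : G → ℝ) k) := rfl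
    rw [Finsupp.linearCombination_single, h1, Finsupp.single_apply, Finsupp.single_apply,
      Pi.single_apply, Pi.single_apply]
    have h2 : h = (g : G)⁻¹ * k ↔ k = g * h := by
      rw [eq_inv_mul_iff_mul_eq, eq_comm]
    simp only [h2, @eq_comm G h k]
    split_ifs <;> ring

/-- An invariant mean can be approximated by finitely supported probability measures that are
almost invariant in `ℓ¹`-norm. -/
theorem IsAmenable.exists_almost_invariant_measure {G : Type u} [Group G] (hG : IsAmenable G)
    (F : Finset G) {ε : ℝ} (hε : 0 < ε) :
    ∃ f : G →₀ ℝ, (∀ k, 0 ≤ f k) ∧ (f.sum fun _ a => a) = 1 ∧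
      ∀ g ∈ F, ∀ S : Finset G, ∑ k ∈ S, |f (g⁻¹ * k) - f k| ≤ ε := by
  classical
  obtain ⟨mean, mean_one, mean_nonneg, mean_inv⟩ := hG
  let P : Set (G →₀ ℝ) := {f | (∀ k, 0 ≤ f k) ∧ Finsupp.linearCombination ℝ (fun _ => (1 : ℝ)) f = 1}
  have hP : Convex ℝ P := by
    intro f hf f' hf' a b ha hb hab
    refine ⟨fun k => ?_, ?_⟩
    · have := hf.1 k
      have := hf'.1 k
      simp only [Finsupp.add_apply, Finsupp.smul_apply, smul_eq_mul]
      positivity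
    · rw [map_add, map_smul, map_smul, hf.2, hf'.2]
      simpa using hab
  let T := Finsupp.linearCombination ℝ (shiftDifference F)
  -- The Day–Namioka argument. `P` is the set of finitely supported probability measures. If all of
  -- them had defect at least ε, Hahn–Banach would give a functional Λ bounded below on their
  -- defects by some c > 0. The components of Λ are bounded functions on G, and the invariant mean
  -- annihilates the differences of their translates, which contradicts c > 0.
  have key : ¬ Disjoint (Metric.ball 0 ε) (T '' P) := by
    intro hdisj
    obtain ⟨Λ, c, hc, hΛ⟩ := geometric_hahn_banach_open (convex_ball 0 ε) Metric.isOpen_ball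
      (hP.linear_image T) hdisj
    have c_pos : 0 < c := by simpa using hc 0 (Metric.mem_ball_self hε)
    have hbound : ∀ (g : F) (h : G),
        ‖Λ (Pi.single g (lp.single 1 h 1))‖ ≤ ‖Λ‖ := by
      intro g h
      refine (Λ.le_opNorm _).trans ?_
      rw [Pi.norm_single, lp.norm_single (by norm_num)]
      simp
    let a : F → lp (fun _ : G => ℝ) ⊤ := fun g =>
      ⟨fun h => Λ (Pi.single g (lp.single 1 h 1)), memℓp_infty
        ⟨‖Λ‖, by rintro _ ⟨h, rfl⟩; exact hbound g h⟩⟩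
    let b : F → lp (fun _ : G => ℝ) ⊤ := fun g =>
      ⟨fun h => Λ (Pi.single g (lp.single 1 (g * h) 1)), memℓp_infty
        ⟨‖Λ‖, by rintro _ ⟨h, rfl⟩; exact hbound g (g * h)⟩⟩
    have hab : ∀ g, mean (b g) = mean (a g) := by
      intro g
      -- `b g` takes at x the value of `a g` at gx, which is its translate by g⁻¹.
      refine mean_inv (g : G)⁻¹ (a g) (b g) fun x => ?_
      rw [inv_inv]
    have hfun : ∀ h, Λ (shiftDifference F h) = ∑ g, (b g h - a g h) := by
      intro h
      have h1 : shiftDifference F h =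
          ∑ g : F, (Pi.single g (lp.single 1 (g * h) 1) -
            Pi.single g (lp.single 1 h 1) : F → lp (fun _ : G => ℝ) 1) := by
        conv_lhs => rw [← Finset.univ_sum_single (shiftDifference F h)]
        refine Finset.sum_congr rfl fun g _ => ?_
        rw [← Pi.single_sub]
        rfl
      rw [h1, map_sum]
      refine Finset.sum_congr rfl fun g _ => ?_
      rw [map_sub]
    have hnonneg : 0 ≤ mean (∑ g, (b g - a g) - c • 1) := by
      refine mean_nonneg _ fun h => ?_
      -- The separation inequality is applied to the point mass at h.
      have h1 : c ≤ Λ (shiftDifference F h) := by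
        refine hΛ _ ⟨Finsupp.single h 1, ⟨fun k => ?_, by simp⟩, by simp [T]⟩
        rw [Finsupp.single_apply]
        split_ifs <;> norm_num
      rw [hfun] at h1
      rw [lp.coeFn_sub, Pi.sub_apply, lp.coeFn_sum, Finset.sum_apply]
      have h2 : (c • (1 : lp (fun _ : G => ℝ) ⊤)) h = c := by
        rw [lp.coeFn_smul, Pi.smul_apply, lp.infty_coeFn_one]
        simp
      rw [h2]
      simpa [sub_nonneg] using h1
    rw [map_sub, map_sum, map_smul, mean_one] at hnonneg
    simp only [map_sub, hab, sub_self, Finset.sum_const_zero] at hnonneg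
    simp at hnonneg
    linarith
  obtain ⟨_, hball, f, hf, rfl⟩ := Set.not_disjoint_iff.1 key
  refine ⟨f, hf.1, ?_, fun g hg S => ?_⟩
  · simpa [Finsupp.linearCombination_apply] using hf.2
  · rw [mem_ball_zero_iff] at hball
    have h1 := lp.sum_rpow_le_norm_rpow (p := 1) (by norm_num) (T f ⟨g, hg⟩) S
    simp only [ENNReal.toReal_one, Real.rpow_one, T, linearCombination_shiftDifference_apply,
      Real.norm_eq_abs] at h1
    exact h1.trans ((norm_le_pi_norm (T f) ⟨g, hg⟩).trans hball.le)

/-- The regular representation of an amenable group has almost invariant finitely supported unit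
vectors. -/
theorem IsAmenable.exists_almost_invariant_vector {G : Type u} [Group G] (hG : IsAmenable G)
    (F : Finset G) {ε : ℝ} (hε : 0 < ε) :
    ∃ (S : Finset G) (ξ : G → ℝ), (∀ h, h ∉ S → ξ h = 0) ∧
      ∀ g ∈ F, |∑ h ∈ S, ξ h * ξ (g⁻¹ * h) - 1| ≤ ε := by
  classical
  obtain ⟨f, f_nonneg, f_sum, hf⟩ := hG.exists_almost_invariant_measure F hε
  -- For ξ = √f, ‖ξ - gξ‖² = 2 - 2⟨ξ, gξ⟩, and (√a - √b)² ≤ |a - b| bounds the left side by the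
  -- ℓ¹-defect of f.
  refine ⟨f.support, fun h => √(f h), fun h hh => ?_, fun g hg => ?_⟩
  · simp [Finsupp.notMem_support_iff.1 hh]
  -- Both f and its translate have total mass 1 on this larger set.
  let S := f.support ∪ f.support.map (Equiv.mulLeft g).toEmbedding
  have hS1 : ∑ k ∈ S, f k = 1 := by
    rw [← f_sum]
    exact (Finset.sum_subset Finset.subset_union_left
      fun k _ hk => Finsupp.notMem_support_iff.1 hk).symm
  have hS2 : ∑ k ∈ S, f (g⁻¹ * k) = 1 := by
    rw [← f_sum, ← Finset.sum_subset (Finset.subset_union_right (s₁ := f.support))]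
    · rw [Finset.sum_map]
      simp [Finsupp.sum]
    · intro k _ hk
      refine Finsupp.notMem_support_iff.1 fun h => hk ?_
      exact Finset.mem_map.2 ⟨_, h, by simp⟩
  have hS3 : ∑ h ∈ f.support, √(f h) * √(f (g⁻¹ * h)) = ∑ k ∈ S, √(f k) * √(f (g⁻¹ * k)) := by
    refine Finset.sum_subset Finset.subset_union_left fun k _ hk => ?_
    simp [Finsupp.notMem_support_iff.1 hk]
  have hS4 : ∑ k ∈ S, (√(f k) - √(f (g⁻¹ * k))) ^ 2 =
      2 - 2 * ∑ k ∈ S, √(f k) * √(f (g⁻¹ * k)) := by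
    have : ∀ k, (√(f k) - √(f (g⁻¹ * k))) ^ 2 =
        f k + f (g⁻¹ * k) - 2 * (√(f k) * √(f (g⁻¹ * k))) := by
      intro k
      rw [sub_sq, Real.sq_sqrt (f_nonneg _), Real.sq_sqrt (f_nonneg _)]
      ring
    simp only [this, Finset.sum_sub_distrib, Finset.sum_add_distrib, hS1, hS2, ← Finset.mul_sum]
    norm_num
  have hS5 : ∑ k ∈ S, (√(f k) - √(f (g⁻¹ * k))) ^ 2 ≤ ε := by
    refine le_trans (Finset.sum_le_sum fun k _ => ?_) (hf g hg S)
    have h1 := Real.sqrt_nonneg (f k)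
    have h2 := Real.sqrt_nonneg (f (g⁻¹ * k))
    have h3 : f (g⁻¹ * k) - f k =
        (√(f (g⁻¹ * k)) - √(f k)) * (√(f (g⁻¹ * k)) + √(f k)) := by
      have h4 := Real.sq_sqrt (f_nonneg k)
      have h5 := Real.sq_sqrt (f_nonneg (g⁻¹ * k))
      nlinarith
    rw [h3, abs_mul, abs_of_nonneg (add_nonneg h2 h1), ← sq_abs, abs_sub_comm, sq]
    refine mul_le_mul_of_nonneg_left ?_ (abs_nonneg _)
    exact abs_sub_le_iff.2 ⟨by linarith, by linarith⟩
  have hS6 : 0 ≤ ∑ k ∈ S, (√(f k) - √(f (g⁻¹ * k))) ^ 2 :=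
    Finset.sum_nonneg fun k _ => sq_nonneg _
  rw [hS3]
  exact abs_le.2 ⟨by linarith, by linarith⟩

end Amenable

/-! ### Vectors of the multiple of the regular representation -/

section Copies

variable {G : Type u}

open scoped Classical in
/-- A finitely supported vector of `∞λ_G` in the coordinates `Nat.pair i j`, `j < d`. -/
def copyVec {d : ℕ} (S : Finset G) (c : G → Fin d → ℂ) (i : ℕ) : InftyRegularSpace G :=
  ∑ h ∈ S, ∑ j : Fin d, lp.single 2 (Nat.pair i j) (lp.single 2 h (c h j))

-- `Nat.pair` is injective, so different i use disjoint copies of ℓ²(G). The resulting vectors are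
-- therefore exactly orthogonal, together with all their translates.
open scoped Classical in
theorem copyVec_apply {d : ℕ} (S : Finset G) (c : G → Fin d → ℂ) (hc : ∀ h, h ∉ S → c h = 0)
    (i i' : ℕ) (j : Fin d) (k : G) :
    copyVec S c i (Nat.pair i' j) k = if i = i' then c k j else 0 := by
  have h1 : copyVec S c i (Nat.pair i' j) k =
      ∑ h ∈ S, ∑ j' : Fin d, (lp.single 2 (Nat.pair i j') (lp.single 2 h (c h j')) :
        InftyRegularSpace G) (Nat.pair i' j) k := by
    rw [copyVec]
    simp only [lp.coeFn_sum, Finset.sum_apply]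
  have h2 : ∀ (h : G) (j' : Fin d), (lp.single 2 (Nat.pair i j') (lp.single 2 h (c h j')) :
      InftyRegularSpace G) (Nat.pair i' j) k =
        if h = k then (if j' = j then (if i = i' then c k j else 0) else 0) else 0 := by
    intro h j'
    rw [lp.single_apply, Pi.single_apply]
    by_cases hi : i = i'
    · by_cases hj : j' = j
      · subst hi hj
        rw [if_pos rfl, lp.single_apply, Pi.single_apply]
        by_cases hk : h = k
        · subst hk; simp
        · simp [hk, Ne.symm hk]
      · have : ¬ Nat.pair i' j = Nat.pair i j' := by
          rw [Nat.pair_eq_pair]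
          rintro ⟨-, h⟩
          exact hj (Fin.ext h.symm)
        simp [this, hj]
    · have : ¬ Nat.pair i' j = Nat.pair i j' := by
        rw [Nat.pair_eq_pair]
        rintro ⟨h, -⟩
        exact hi h.symm
      simp [this, hi]
  rw [h1]
  simp only [h2]
  by_cases hk : k ∈ S
  · simp [hk]
  · simp [hc k hk]

theorem inner_copyVec [Group G] {d : ℕ} (S : Finset G) (c : G → Fin d → ℂ) (i : ℕ)
    (y : InftyRegularSpace G) (g : G) :
    inner ℂ (copyVec S c i) (inftyRegularRep G g y) =
      ∑ h ∈ S, ∑ j : Fin d, star (c h j) * y (Nat.pair i j) (g⁻¹ * h) := by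
  classical
  rw [copyVec, sum_inner]
  refine Finset.sum_congr rfl fun h _ => ?_
  rw [sum_inner]
  refine Finset.sum_congr rfl fun j _ => ?_
  rw [lp.inner_single_left, lp.inner_single_left]
  exact mul_comm _ _

/-- For amenable `G`, every positive definite function on `G` is approximated on finite sets by
coefficients of infinitely many mutually orthogonal vectors of `∞λ_G`. -/
theorem IsAmenable.exists_orthogonal_copies [Group G] (hG : IsAmenable G) {H : Type v}
    [NormedAddCommGroup H] [InnerProductSpace ℂ H] (π : UnitaryRep G H) (e : H) (F : Finset G)
    {ε : ℝ} (hε : 0 < ε) :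
    ∃ f : ℕ → InftyRegularSpace G, ∀ i j, ∀ g ∈ F,
      ‖inner ℂ (f i) (inftyRegularRep G g (f j)) -
        if i = j then inner ℂ e (π g e) else 0‖ ≤ ε := by
  classical
  -- Fell absorption: untwisting λ ⊗ π turns ξ ⊗ e into the function h ↦ ξ(h) π(h⁻¹)e, whose
  -- coefficient at g is ⟨ξ, λ(g)ξ⟩⟨e, π(g)e⟩. The divisor ‖e‖² + 1 compensates for the size of the
  -- second factor.
  obtain ⟨S, ξ, hξ, hS⟩ :=
    hG.exists_almost_invariant_vector F (ε := ε / (‖e‖ ^ 2 + 1)) (by positivity)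
  -- Since S is finite, the values π(h⁻¹)e span a finite-dimensional space; its orthonormal
  -- coordinates are spread over finitely many copies of λ_G.
  let W : Submodule ℂ H := Submodule.span ℂ ((fun h => π h⁻¹ e) '' (S : Set G))
  have hW : ∀ h ∈ S, π h⁻¹ e ∈ W := fun h hh => Submodule.subset_span ⟨h, hh, rfl⟩
  have : FiniteDimensional ℂ W := FiniteDimensional.span_of_finite ℂ (S.finite_toSet.image _)
  let b := stdOrthonormalBasis ℂ W
  have hb : ∀ v ∈ W, ∀ w ∈ W, ∑ j, inner ℂ v (b j : H) * inner ℂ (b j : H) w = inner ℂ v w :=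
    fun v hv w hw => b.sum_inner_mul_inner ⟨v, hv⟩ ⟨w, hw⟩
  let c : G → Fin (Module.finrank ℂ W) → ℂ := fun h j => ξ h * inner ℂ (b j : H) (π h⁻¹ e)
  have hc : ∀ h, h ∉ S → c h = 0 := by
    intro h hh
    funext j
    simp [c, hξ h hh]
  refine ⟨copyVec S c, fun i j g hg => ?_⟩
  rw [inner_copyVec]
  simp only [copyVec_apply S c hc]
  by_cases hij : i = j
  · subst hij
    simp only [if_true]
    -- Parseval in W, followed by unitarity of π(h⁻¹). If g⁻¹h lies outside S, both sides vanish.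
    have h1 : ∀ h ∈ S, ∑ j, star (c h j) * c (g⁻¹ * h) j =
        ((ξ h * ξ (g⁻¹ * h) : ℝ) : ℂ) * inner ℂ e (π g e) := by
      intro h hh
      by_cases hg' : g⁻¹ * h ∈ S
      · have h2 := hb _ (hW h hh) _ (hW _ hg')
        have h3 : π (g⁻¹ * h)⁻¹ e = π h⁻¹ (π g e) := by simp
        rw [h3, (π h⁻¹).inner_map_map] at h2
        rw [← h2, Finset.mul_sum]
        refine Finset.sum_congr rfl fun j _ => ?_
        simp only [c, h3, star_mul', Complex.star_def, Complex.conj_ofReal, inner_conj_symm]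
        push_cast
        ring
      · simp [hc _ hg', hξ _ hg']
    rw [Finset.sum_congr rfl h1, ← Finset.sum_mul, ← Complex.ofReal_sum]
    have h4 : ∀ (a : ℝ) (z : ℂ), (a : ℂ) * z - z = ((a - 1 : ℝ) : ℂ) * z := by
      intro a z; push_cast; ring
    rw [h4, norm_mul, Complex.norm_real, Real.norm_eq_abs]
    have h5 : ‖(inner ℂ e (π g e) : ℂ)‖ ≤ ‖e‖ ^ 2 + 1 := by
      have := norm_inner_le_norm (𝕜 := ℂ) e (π g e)
      rw [(π g).norm_map] at this
      nlinarith
    calc _ ≤ ε / (‖e‖ ^ 2 + 1) * (‖e‖ ^ 2 + 1) :=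
          mul_le_mul (hS g hg) h5 (norm_nonneg _) (by positivity)
      _ = ε := by field_simp
  · simp [hij, Ne.symm hij, hε.le]

end Copies

/-! ### Approximate copies of vectors in models of `Σ_G⁻` -/

section Bessel

variable {K : Type w} [NormedAddCommGroup K] [InnerProductSpace ℂ K]

/-- Bessel's inequality for almost orthogonal vectors. -/
theorem sum_norm_inner_sq_le {N : ℕ} (d : Fin N → K) {C η : ℝ} (hC : ∀ i, ‖d i‖ ^ 2 ≤ C)
    (hη : ∀ i j, i ≠ j → ‖(inner ℂ (d i) (d j) : ℂ)‖ ≤ η) (hC0 : 0 ≤ C) (hη0 : 0 ≤ η) (b : K) :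
    ∑ i, ‖(inner ℂ (d i) b : ℂ)‖ ^ 2 ≤ ‖b‖ ^ 2 * (C + N * η) := by
  let c : Fin N → ℂ := fun i => inner ℂ (d i) b
  -- With s = ∑|c_i|², the vector u satisfies ⟨u, b⟩ = s and ‖u‖² ≤ (C + Nη)s. Cauchy–Schwarz for u
  -- and b then gives the bound after division by s.
  let u : K := ∑ i, c i • d i
  set s : ℝ := ∑ i, ‖c i‖ ^ 2 with hs
  have hs0 : 0 ≤ s := Finset.sum_nonneg fun i _ => sq_nonneg _
  have hub : (inner ℂ u b : ℂ) = s := by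
    simp only [u, sum_inner, inner_smul_left, hs, Complex.ofReal_sum]
    refine Finset.sum_congr rfl fun i _ => ?_
    change (starRingEnd ℂ) (c i) * c i = _
    rw [Complex.conj_mul']
    norm_cast
  have hsu : s ≤ ‖u‖ * ‖b‖ := by
    have := norm_inner_le_norm (𝕜 := ℂ) u b
    rwa [hub, Complex.norm_real, Real.norm_of_nonneg hs0] at this
  have huu : ‖u‖ ^ 2 ≤ (C + N * η) * s := by
    have h1 : ‖u‖ ^ 2 ≤ ∑ i, ∑ j, ‖c i‖ * ‖c j‖ * ‖(inner ℂ (d i) (d j) : ℂ)‖ := by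
      have h2 : ‖u‖ ^ 2 = ‖(inner ℂ u u : ℂ)‖ := by
        rw [inner_self_eq_norm_sq_to_K]; simp
      have h3 : (inner ℂ u u : ℂ) =
          ∑ i, ∑ j, (starRingEnd ℂ) (c i) * (c j * inner ℂ (d i) (d j)) := by
        simp only [u, sum_inner, inner_smul_left]
        refine Finset.sum_congr rfl fun i _ => ?_
        simp only [inner_sum, inner_smul_right, Finset.mul_sum]
      rw [h2, h3]
      refine (norm_sum_le _ _).trans (Finset.sum_le_sum fun i _ => ?_)
      refine (norm_sum_le _ _).trans (Finset.sum_le_sum fun j _ => ?_)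
      rw [norm_mul, norm_mul, RCLike.norm_conj]
      exact le_of_eq (by ring)
    have h3 : ∀ i j, ‖c i‖ * ‖c j‖ * ‖(inner ℂ (d i) (d j) : ℂ)‖ ≤
        (if i = j then ‖c i‖ ^ 2 * C else 0) + ‖c i‖ * ‖c j‖ * η := by
      intro i j
      split_ifs with hij
      · subst hij
        have h4 : ‖(inner ℂ (d i) (d i) : ℂ)‖ ≤ C := by
          rw [inner_self_eq_norm_sq_to_K]; simpa using hC i
        have h5 : ‖c i‖ * ‖c i‖ * ‖(inner ℂ (d i) (d i) : ℂ)‖ ≤ ‖c i‖ * ‖c i‖ * C :=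
          mul_le_mul_of_nonneg_left h4 (by positivity)
        have h6 : 0 ≤ ‖c i‖ * ‖c i‖ * η := by positivity
        rw [sq]
        linarith
      · rw [zero_add]
        exact mul_le_mul_of_nonneg_left (hη i j hij) (by positivity)
    have h7 : ∑ i, ∑ j, ((if i = j then ‖c i‖ ^ 2 * C else 0) + ‖c i‖ * ‖c j‖ * η) =
        C * s + η * (∑ i, ‖c i‖) ^ 2 := by
      simp only [Finset.sum_add_distrib, Finset.sum_ite_eq, Finset.mem_univ, if_true]
      rw [← Finset.sum_mul, ← hs, sq, Finset.sum_mul_sum]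
      simp only [← Finset.sum_mul]
      ring
    have h8 : (∑ i, ‖c i‖) ^ 2 ≤ N * s := by
      simpa using sq_sum_le_card_mul_sum_sq (s := Finset.univ) (f := fun i => ‖c i‖)
    calc ‖u‖ ^ 2 ≤ _ := h1
      _ ≤ _ := Finset.sum_le_sum fun i _ => Finset.sum_le_sum fun j _ => h3 i j
      _ = _ := h7
      _ ≤ C * s + η * (N * s) := by gcongr
      _ = _ := by ring
  have h9 : s ^ 2 ≤ ‖b‖ ^ 2 * (C + N * η) * s := by
    calc s ^ 2 ≤ (‖u‖ * ‖b‖) ^ 2 := by gcongr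
      _ = ‖u‖ ^ 2 * ‖b‖ ^ 2 := by ring
      _ ≤ (C + N * η) * s * ‖b‖ ^ 2 := by gcongr
      _ = _ := by ring
  change s ≤ _
  rcases hs0.eq_or_lt with h | h
  · rw [← h]; positivity
  · rw [sq] at h9
    exact le_of_mul_le_mul_right h9 h

/-- Among sufficiently many almost orthogonal bounded vectors, one is almost orthogonal to finitely
many given vectors. -/
theorem exists_almost_orthogonal {κ : Type*} [Fintype κ] (b : κ → K) {C ε : ℝ} (hC0 : 0 ≤ C)
    (hε : 0 < ε) : ∃ N : ℕ, ∀ d : Fin N → K, (∀ i, ‖d i‖ ^ 2 ≤ C) →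
      (∀ i j, i ≠ j → ‖(inner ℂ (d i) (d j) : ℂ)‖ ≤ 1 / (N + 1)) →
      ∃ i, ∀ k, ‖(inner ℂ (d i) (b k) : ℂ)‖ ≤ ε := by
  -- If every d_i had an inner product above ε with some b_k, summing squares would give Nε² ≤
  -- ∑‖b_k‖²(C + 1). The tolerance 1/(N + 1) keeps the Bessel error Nη below 1.
  obtain ⟨N, hN⟩ := exists_nat_gt ((∑ k, ‖b k‖ ^ 2 * (C + 1)) / ε ^ 2)
  refine ⟨N, fun d hd hdd => ?_⟩
  by_contra! hcon
  have h1 : ∀ k, ∑ i, ‖(inner ℂ (d i) (b k) : ℂ)‖ ^ 2 ≤ ‖b k‖ ^ 2 * (C + 1) := by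
    intro k
    refine (sum_norm_inner_sq_le d hd hdd hC0 (by positivity) (b k)).trans ?_
    have : (N : ℝ) * (1 / (N + 1)) ≤ 1 := by
      rw [mul_one_div, div_le_one (by positivity)]
      linarith
    gcongr
  have h2 : ∀ i, ε ^ 2 ≤ ∑ k, ‖(inner ℂ (d i) (b k) : ℂ)‖ ^ 2 := by
    intro i
    obtain ⟨k, hk⟩ := hcon i
    calc ε ^ 2 ≤ ‖(inner ℂ (d i) (b k) : ℂ)‖ ^ 2 := by gcongr
      _ ≤ _ := Finset.single_le_sum (f := fun k => ‖(inner ℂ (d i) (b k) : ℂ)‖ ^ 2)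
        (fun k _ => sq_nonneg _) (Finset.mem_univ k)
  have h3 : (N : ℝ) * ε ^ 2 ≤ ∑ k, ‖b k‖ ^ 2 * (C + 1) := by
    calc (N : ℝ) * ε ^ 2 = ∑ _i : Fin N, ε ^ 2 := by simp
      _ ≤ ∑ i, ∑ k, ‖(inner ℂ (d i) (b k) : ℂ)‖ ^ 2 := Finset.sum_le_sum fun i _ => h2 i
      _ = ∑ k, ∑ i, ‖(inner ℂ (d i) (b k) : ℂ)‖ ^ 2 := Finset.sum_comm
      _ ≤ _ := Finset.sum_le_sum fun k _ => h1 k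
  rw [div_lt_iff₀ (by positivity)] at hN
  linarith

end Bessel

-- Richness of models of Σ_G⁻

section Rich

variable {G : Type u}

/-- The formula saying that the values `⟨x_i, g x_j⟩`, `g ∈ F`, are within `√η` of given complex
numbers. -/
def gramBox (η : ℚ) {m : ℕ} (F : Finset G) (q : Fin m → Fin m → G → ℚ × ℚ) : Formula G m 0 :=
  boxFormula η (((Finset.univ : Finset (Fin m × Fin m)) ×ˢ F).toList.map fun p =>
    (.sinner (.vvar p.1.1) (.vact p.2 (.vvar p.1.2)), q p.1.1 p.1.2 p.2))

theorem realize_gramBox {η : ℚ} (hη : 0 ≤ η) {m : ℕ} (F : Finset G)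
    (q : Fin m → Fin m → G → ℚ × ℚ) (M : LGStructure.{u, v} G) (x : Fin m → M.carrier) :
    (gramBox η F q).Realize M x ![] ↔ ∀ i j, ∀ g ∈ F,
      ‖M.ip (x i) (M.act g (x j)) - ratComplex (q i j g)‖ ^ 2 ≤ (η : ℝ) := by
  rw [gramBox, realize_boxFormula hη, List.forall_mem_map]
  simp

/-- A model of `Σ_G⁻` contains, for amenable `G`, approximate copies of every finite family of
mutually orthogonal copies of a vector of a unitary representation. -/
theorem exists_approx_copies [Group G] (hG : IsAmenable G) {H : Type v} [NormedAddCommGroup H]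
    [InnerProductSpace ℂ H] (π : UnitaryRep G H) (e : H) {K : Type w} [NormedAddCommGroup K]
    [InnerProductSpace ℂ K] [CompleteSpace K] (ρ : UnitaryRep G K)
    (hρ : IsModel (ofRep ρ) (sigmaGMinus G)) (F : Finset G) (N : ℕ) {δ : ℚ} (hδ : 0 < δ) :
    ∃ d : Fin N → K, ∀ i j, ∀ g ∈ F,
      ‖inner ℂ (d i) (ρ g (d j)) - if i = j then inner ℂ e (π g e) else 0‖ ≤ (δ : ℝ) := by
  have hδ' : (0 : ℝ) < δ := by exact_mod_cast hδ
  -- Budget: δ/4 for the copies and δ/4 for rational centres give boxes of radius δ/2, that is η =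
  -- δ²/4. The formula is relaxed twice, once for membership in Σ_G⁻ (δ²/2) and once for approximate
  -- satisfaction (9δ²/16, radius 3δ/4). The centres cost the last δ/4.
  obtain ⟨f, hf⟩ := hG.exists_orthogonal_copies π e F (ε := δ / 4) (by positivity)
  have hq : ∀ (i j : Fin N) (g : G), ∃ q,
      ‖(if i = j then inner ℂ e (π g e) else 0) - ratComplex q‖ < (δ : ℝ) / 4 :=
    fun i j g => exists_ratComplex_near _ (by positivity)
  choose q hq using hq
  obtain ⟨r, hr⟩ := PosRat.exists_gt (∑ i : Fin N, ‖f i‖)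
  obtain ⟨r', hr'⟩ := PosRat.exists_gt (r : ℚ)
  obtain ⟨r'', hr''⟩ := PosRat.exists_gt (r' : ℚ)
  have hmem : exBlock r' (gramBox (δ ^ 2 / 2) F q) ∈ sigmaGMinus G := by
    refine ⟨exBlock r (gramBox (δ ^ 2 / 4) F q),
      ⟨exBlock_isExistential r (.qf (boxFormula_isQF _ _)), ?_⟩,
      exBlock_approx (by exact_mod_cast hr') (boxFormula_approx (by nlinarith) _)⟩
    refine (satisfies_exBlock _ _ _).2 ⟨fun i => f i, fun i => ?_, ?_⟩
    · exact (Finset.single_le_sum (f := fun i : Fin N => ‖f i‖) (fun i _ => norm_nonneg _)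
        (Finset.mem_univ i)).trans hr.le
    · refine (realize_gramBox (by positivity) F q (inftyRegular G) _).2 fun i j g hg => ?_
      have h1 := hf i j g hg
      have h2 := hq i j g
      simp only [Fin.val_inj] at h1
      have h3 := norm_sub_le_norm_sub_add_norm_sub
        (inner ℂ (f i) (inftyRegularRep G g (f j)) : ℂ)
        (if i = j then inner ℂ e (π g e) else 0) (ratComplex (q i j g))
      change ‖inner ℂ (f i) (inftyRegularRep G g (f j)) - ratComplex (q i j g)‖ ^ 2 ≤ _
      have h4 : ‖inner ℂ (f i) (inftyRegularRep G g (f j)) - ratComplex (q i j g)‖ ≤ (δ : ℝ) / 2 := by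
        linarith
      calc _ ≤ ((δ : ℝ) / 2) ^ 2 := by gcongr
        _ = _ := by push_cast; ring
  have happrox := hρ _ hmem _ (exBlock_approx (r' := r'') (by exact_mod_cast hr'')
    (boxFormula_approx (η' := 9 * δ ^ 2 / 16) (by nlinarith) _))
  obtain ⟨d, -, hd⟩ := (satisfies_exBlock _ _ _).1 happrox
  refine ⟨d, fun i j g hg => ?_⟩
  have h1 : ‖inner ℂ (d i) (ρ g (d j)) - ratComplex (q i j g)‖ ^ 2 ≤
      ((9 * δ ^ 2 / 16 : ℚ) : ℝ) :=
    (realize_gramBox (by positivity) F q (ofRep ρ) d).1 hd i j g hg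
  have h2 : ‖inner ℂ (d i) (ρ g (d j)) - ratComplex (q i j g)‖ ≤ 3 * (δ : ℝ) / 4 := by
    refine le_of_sq_le_sq (h1.trans (le_of_eq ?_)) (by positivity)
    push_cast
    ring
  have h3 := norm_sub_le_norm_sub_add_norm_sub (inner ℂ (d i) (ρ g (d j)) : ℂ)
    (ratComplex (q i j g)) (if i = j then inner ℂ e (π g e) else 0)
  have h4 := hq i j g
  rw [norm_sub_rev] at h4
  linarith

/-- In a model of `Σ_G⁻`, for amenable `G`, every vector of a unitary representation has an
approximate copy that is almost orthogonal to finitely many given vectors. -/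
theorem exists_approx_copy [Group G] (hG : IsAmenable G) {H : Type v} [NormedAddCommGroup H]
    [InnerProductSpace ℂ H] (π : UnitaryRep G H) (e : H) {K : Type w} [NormedAddCommGroup K]
    [InnerProductSpace ℂ K] [CompleteSpace K] (ρ : UnitaryRep G K)
    (hρ : IsModel (ofRep ρ) (sigmaGMinus G)) (F : Finset G) {κ : Type*} [Fintype κ] (b : κ → K)
    {ε : ℝ} (hε : 0 < ε) :
    ∃ e' : K, (∀ g ∈ F, ‖(inner ℂ e (π g e) - inner ℂ e' (ρ g e') : ℂ)‖ ≤ ε) ∧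
      ∀ k, ‖(inner ℂ e' (b k) : ℂ)‖ ≤ ε := by
  classical
  obtain ⟨N, hN⟩ := exists_almost_orthogonal b (C := ‖e‖ ^ 2 + 1) (by positivity) hε
  obtain ⟨δ, hδ0, hδ⟩ : ∃ δ : ℚ, (0 : ℝ) < δ ∧ (δ : ℝ) < min ε (1 / (N + 1)) :=
    exists_rat_btwn (lt_min hε (by positivity))
  rw [lt_min_iff] at hδ
  -- The element 1 is added to F to control the norms of the d_i and their mutual inner products; as
  -- δ ≤ 1, ‖d_i‖² ≤ ‖e‖² + 1.
  obtain ⟨d, hd⟩ := exists_approx_copies hG π e ρ hρ (insert 1 F) N (by exact_mod_cast hδ0)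
  have hδ1 : (δ : ℝ) ≤ 1 := by
    refine hδ.2.le.trans ?_
    rw [div_le_one (by positivity)]
    linarith [(Nat.cast_nonneg N : (0 : ℝ) ≤ N)]
  obtain ⟨i, hi⟩ := hN d
    (fun i => by
      have h := hd i i 1 (Finset.mem_insert_self _ _)
      simp only [if_true, map_one, LinearIsometryEquiv.coe_one, id_eq] at h
      rw [inner_self_eq_norm_sq_to_K, inner_self_eq_norm_sq_to_K] at h
      have h' : |‖d i‖ ^ 2 - ‖e‖ ^ 2| ≤ (δ : ℝ) := by
        rw [← Real.norm_eq_abs, ← Complex.norm_real]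
        push_cast
        exact h
      linarith [(abs_le.1 h').2])
    (fun i j hij => by
      have h := hd i j 1 (Finset.mem_insert_self _ _)
      simp only [if_neg hij, map_one, LinearIsometryEquiv.coe_one, id_eq, sub_zero] at h
      exact h.trans hδ.2.le)
  refine ⟨d i, fun g hg => ?_, hi⟩
  have h := hd i i g (Finset.mem_insert_of_mem hg)
  rw [if_pos rfl, norm_sub_rev] at h
  exact h.trans hδ.1.le

end Rich

/-! ### Closeness of tuples and the extension property -/

section Extension

variable {G : Type u} [Group G]

/-- Two tuples in unitary representations are close if the values `⟨x_i, g x_j⟩` are close for all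
`g` in a finite set. -/
def Close (F : Finset G) (δ : ℝ) {H : Type v} [NormedAddCommGroup H] [InnerProductSpace ℂ H]
    (π : UnitaryRep G H) {K : Type w} [NormedAddCommGroup K] [InnerProductSpace ℂ K]
    (ρ : UnitaryRep G K) {m : ℕ} (x : Fin m → H) (y : Fin m → K) : Prop :=
  ∀ i j, ∀ g ∈ F, ‖(inner ℂ (x i) (π g (x j)) - inner ℂ (y i) (ρ g (y j)) : ℂ)‖ ≤ δ

theorem inner_act_act {H : Type v} [NormedAddCommGroup H] [InnerProductSpace ℂ H]
    (π : UnitaryRep G H) (g h : G) (x y : H) :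
    (inner ℂ (π g x) (π h y) : ℂ) = inner ℂ x (π (g⁻¹ * h) y) := by
  rw [← (π g⁻¹).inner_map_map]
  simp

theorem inner_act_left {H : Type v} [NormedAddCommGroup H] [InnerProductSpace ℂ H]
    (π : UnitaryRep G H) (g : G) (x y : H) :
    (inner ℂ x (π g y) : ℂ) = star (inner ℂ y (π g⁻¹ x)) := by
  rw [Complex.star_def, inner_conj_symm, ← (π g⁻¹).inner_map_map]
  simp

variable {H : Type v} [NormedAddCommGroup H] [InnerProductSpace ℂ H] {π : UnitaryRep G H}
  {K : Type w} [NormedAddCommGroup K] [InnerProductSpace ℂ K] {ρ : UnitaryRep G K} {m : ℕ}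
  {x : Fin m → H} {y : Fin m → K}

theorem Close.mono {F F' : Finset G} {δ δ' : ℝ} (h : Close F δ π ρ x y) (hF : F' ⊆ F)
    (hδ : δ ≤ δ') : Close F' δ' π ρ x y :=
  fun i j g hg => (h i j g (hF hg)).trans hδ

theorem Close.symm {F : Finset G} {δ : ℝ} (h : Close F δ π ρ x y) : Close F δ ρ π y x :=
  fun i j g hg => by rw [norm_sub_rev]; exact h i j g hg

/-- Since ⟨c, g x_i⟩ is the conjugate of ⟨x_i, g⁻¹c⟩, a symmetric F makes one kind of mixed
coefficient enough. -/
theorem Close.cons {F : Finset G} (hF : ∀ g ∈ F, g⁻¹ ∈ F) {δ : ℝ} (h : Close F δ π ρ x y)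
    {c : H} {d : K}
    (h0 : ∀ g ∈ F, ‖(inner ℂ c (π g c) - inner ℂ d (ρ g d) : ℂ)‖ ≤ δ)
    (h1 : ∀ i, ∀ g ∈ F, ‖(inner ℂ (x i) (π g c) - inner ℂ (y i) (ρ g d) : ℂ)‖ ≤ δ) :
    Close F δ π ρ (Matrix.vecCons c x) (Matrix.vecCons d y) := by
  intro i j g hg
  refine Fin.cases ?_ (fun i => ?_) i <;> refine Fin.cases ?_ (fun j => ?_) j
  · exact h0 g hg
  · simp only [Matrix.cons_val_zero, Matrix.cons_val_succ]
    rw [inner_act_left π, inner_act_left ρ, ← star_sub, norm_star]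
    exact h1 j _ (hF g hg)
  · exact h1 i g hg
  · exact h i j g hg

theorem Close.tail {F : Finset G} {δ : ℝ} {c : H} {d : K}
    (h : Close F δ π ρ (Matrix.vecCons c x) (Matrix.vecCons d y)) : Close F δ π ρ x y :=
  fun i j g hg => h i.succ j.succ g hg

theorem norm_add_mul_sub_add_mul_le {t : ℂ} (ht : ‖t‖ ≤ 1) {a b a' b' : ℂ} {α β : ℝ}
    (ha : ‖a - a'‖ ≤ α) (hb : ‖b - b'‖ ≤ β) : ‖(a + t * b) - (a' + t * b')‖ ≤ α + β := by
  have h : (a + t * b) - (a' + t * b') = (a - a') + t * (b - b') := by ring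
  rw [h]
  refine (norm_add_le _ _).trans (add_le_add ha ?_)
  rw [norm_mul]
  exact (mul_le_of_le_one_left (norm_nonneg _) ht).trans hb

open scoped Pointwise Classical in
/-- Closeness is preserved when a multiple of a translate of an entry is added to the first
entry. -/
theorem Close.step {F E : Finset G} (hF : 1 ∈ F) (hE : ∀ g ∈ E, g⁻¹ ∈ E) {δ : ℝ} {v : H} {w : K}
    (h : Close (F⁻¹ * E * F) δ π ρ (Matrix.vecCons v x) (Matrix.vecCons w y)) {g : G}
    (hg : g ∈ F) {t : ℂ} (ht : ‖t‖ ≤ 1) (b : Fin (m + 1)) (hδ : 0 ≤ δ) :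
    Close E (4 * δ) π ρ
      (Matrix.vecCons (v + t • π g ((Matrix.vecCons v x : Fin (m + 1) → H) b)) x)
      (Matrix.vecCons (w + t • ρ g ((Matrix.vecCons w y : Fin (m + 1) → K) b)) y) := by
  set X : Fin (m + 1) → H := Matrix.vecCons v x with hX
  set Y : Fin (m + 1) → K := Matrix.vecCons w y with hY
  have hv : v = X 0 := rfl
  have hw : w = Y 0 := rfl
  -- The new coefficients at k ∈ E expand into old ones at a⁻¹kc with a, c ∈ {1, g}. At most four
  -- occur, with factors of modulus at most 1, which explains 4δ.
  have hsub : ∀ a ∈ F, ∀ k ∈ E, ∀ c ∈ F, a⁻¹ * k * c ∈ F⁻¹ * E * F := fun a ha k hk c hc =>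
    Finset.mul_mem_mul (Finset.mul_mem_mul (Finset.inv_mem_inv ha) hk) hc
  have hXY : ∀ i j, ∀ a ∈ F, ∀ c ∈ F, ∀ k ∈ E,
      ‖(inner ℂ (π a (X i)) (π k (π c (X j))) - inner ℂ (ρ a (Y i)) (ρ k (ρ c (Y j))) : ℂ)‖
        ≤ δ := by
    intro i j a ha c hc k hk
    have h1 := h i j _ (hsub a ha k hk c hc)
    have h2 : ∀ v, π k (π c v) = π (k * c) v := fun v => by rw [map_mul]; rfl
    have h3 : ∀ v, ρ k (ρ c v) = ρ (k * c) v := fun v => by rw [map_mul]; rfl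
    rw [h2, h3, inner_act_act, inner_act_act, ← mul_assoc]
    exact h1
  have hright : ∀ i, ∀ a ∈ F, ∀ k ∈ E,
      ‖(inner ℂ (π a (X i)) (π k (v + t • π g (X b))) -
        inner ℂ (ρ a (Y i)) (ρ k (w + t • ρ g (Y b))) : ℂ)‖ ≤ δ + δ := by
    intro i a ha k hk
    simp only [map_add, map_smul, inner_add_right, inner_smul_right]
    refine norm_add_mul_sub_add_mul_le ht ?_ (hXY i b a ha g hg k hk)
    simpa [hv, hw] using hXY i 0 a ha 1 hF k hk
  refine Close.cons hE ?_ ?_ ?_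
  · refine (Close.tail (h.mono (fun k hk => ?_) (by linarith)))
    simpa using hsub 1 hF k hk 1 hF
  · intro k hk
    rw [inner_add_left, inner_add_left, inner_smul_left, inner_smul_left]
    refine (norm_add_mul_sub_add_mul_le (by simpa using ht) ?_ (hright b g hg k hk)).trans
      (le_of_eq (by ring : (δ + δ) + (δ + δ) = 4 * δ))
    have h1 := hright 0 1 hF k hk
    simp only [map_one, LinearIsometryEquiv.coe_one, id_eq] at h1
    exact h1
  · intro i k hk
    have := hright i.succ 1 hF k hk
    simp only [map_one, LinearIsometryEquiv.coe_one, id_eq] at this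
    exact this.trans (by linarith)

/-- Pairs of corresponding linear combinations of translates of two tuples, obtained in a given
number of steps. -/
inductive Reach (F : Finset G) (π : UnitaryRep G H) (ρ : UnitaryRep G K) (x : Fin m → H)
    (y : Fin m → K) : ℕ → H → K → Prop
  | zero : Reach F π ρ x y 0 0 0
  -- The index b = 0 allows translates of the current v itself. They are needed so that the
  -- remainder c - v can be made almost orthogonal to translates of v too.
  | step {k : ℕ} {v : H} {w : K} (h : Reach F π ρ x y k v w) {g : G} (hg : g ∈ F) {t : ℂ}
      (ht : ‖t‖ ≤ 1) (b : Fin (m + 1)) : Reach F π ρ x y (k + 1)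
        (v + t • π g ((Matrix.vecCons v x : Fin (m + 1) → H) b))
        (w + t • ρ g ((Matrix.vecCons w y : Fin (m + 1) → K) b))

end Extension

-- Greedy approximation and the extension property

section Extension

variable {G : Type u} [Group G]

/-- Each step is paid for by replacing E with F⁻¹(E ∪ E⁻¹)F and dividing the tolerance by 4. The
resulting F' and δ depend neither on the representations nor on the coefficients used. -/
theorem exists_close_of_reach (m : ℕ) {F : Finset G} (hF : 1 ∈ F) (k : ℕ) (E : Finset G) {ε : ℝ}
    (hε : 0 < ε) : ∃ (F' : Finset G) (δ : ℝ), 0 < δ ∧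
      ∀ {H : Type v} [NormedAddCommGroup H] [InnerProductSpace ℂ H] (π : UnitaryRep G H)
        {K : Type w} [NormedAddCommGroup K] [InnerProductSpace ℂ K] (ρ : UnitaryRep G K)
        (x : Fin m → H) (y : Fin m → K), Close F' δ π ρ x y →
        ∀ v w, Reach F π ρ x y k v w →
          Close E ε π ρ (Matrix.vecCons v x) (Matrix.vecCons w y) := by
  classical
  open scoped Pointwise in
  induction k generalizing E ε with
  | zero =>
    refine ⟨E ∪ E⁻¹, ε, hε, fun {H} _ _ π {K} _ _ ρ x y h v w hr => ?_⟩
    cases hr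
    refine Close.mono (F := E ∪ E⁻¹) (Close.cons ?_ h ?_ ?_) Finset.subset_union_left le_rfl
    · intro g hg
      simpa [or_comm] using hg
    · intro g _
      simpa using hε.le
    · intro i g _
      simpa using hε.le
  | succ k ih =>
    obtain ⟨F', δ, hδ, ih⟩ := ih (F⁻¹ * (E ∪ E⁻¹) * F) (ε := ε / 4) (by positivity)
    refine ⟨F', δ, hδ, fun {H} _ _ π {K} _ _ ρ x y h v w hr => ?_⟩
    cases hr with
    | step hr hg ht b =>
      refine (Close.step hF ?_ (ih π ρ x y h _ _ hr) hg ht b (by positivity)).mono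
        (Finset.subset_union_left : E ⊆ E ∪ E⁻¹) (by linarith)
      intro g hg
      simpa [or_comm] using hg

/-- Greedy approximation stops after an unknown number of steps that is only bounded by N, so one F'
and δ must serve all k ≤ N. -/
theorem exists_close_of_reach_le (m : ℕ) {F : Finset G} (hF : 1 ∈ F) (N : ℕ) (E : Finset G)
    {ε : ℝ} (hε : 0 < ε) : ∃ (F' : Finset G) (δ : ℝ), 0 < δ ∧
      ∀ {H : Type v} [NormedAddCommGroup H] [InnerProductSpace ℂ H] (π : UnitaryRep G H)
        {K : Type w} [NormedAddCommGroup K] [InnerProductSpace ℂ K] (ρ : UnitaryRep G K)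
        (x : Fin m → H) (y : Fin m → K), Close F' δ π ρ x y →
        ∀ k ≤ N, ∀ v w, Reach F π ρ x y k v w →
          Close E ε π ρ (Matrix.vecCons v x) (Matrix.vecCons w y) := by
  classical
  induction N with
  | zero =>
    obtain ⟨F', δ, hδ, h₀⟩ := exists_close_of_reach.{u, v, w} m hF 0 E hε
    refine ⟨F', δ, hδ, fun {H} _ _ π {K} _ _ ρ x y h k hk => ?_⟩
    obtain rfl : k = 0 := by omega
    exact h₀ π ρ x y h
  | succ N ih =>
    obtain ⟨F₁, δ₁, hδ₁, H₁⟩ := ih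
    obtain ⟨F₂, δ₂, hδ₂, H₂⟩ := exists_close_of_reach.{u, v, w} m hF (N + 1) E hε
    refine ⟨F₁ ∪ F₂, min δ₁ δ₂, lt_min hδ₁ hδ₂, fun {H} _ _ π {K} _ _ ρ x y h k hk => ?_⟩
    rcases hk.lt_or_eq with hk | rfl
    · exact H₁ π ρ x y (h.mono Finset.subset_union_left (min_le_left _ _)) k (by omega)
    · exact H₂ π ρ x y (h.mono Finset.subset_union_right (min_le_right _ _))

/-- If a vector cannot be shortened much by subtracting multiples of `v`, it is almost orthogonal
to `v`. -/
theorem norm_inner_le_of_stationary {H : Type v} [NormedAddCommGroup H] [InnerProductSpace ℂ H]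
    {e v : H} {B ε : ℝ} (hB : 0 < B) (hε : 0 ≤ ε) (he : ‖e‖ ≤ B) (hv : ‖v‖ ≤ B)
    (h : ∀ t : ℂ, ‖t‖ ≤ 1 → ‖e‖ ^ 2 - (ε / B) ^ 2 ≤ ‖e - t • v‖ ^ 2) :
    ‖(inner ℂ e v : ℂ)‖ ≤ ε := by
  set a : ℝ := ‖(inner ℂ e v : ℂ)‖ with ha
  have ha0 : 0 ≤ a := norm_nonneg _
  have haB : a ≤ B ^ 2 := by
    refine (norm_inner_le_norm e v).trans ?_
    rw [sq]
    gcongr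
  have hnorm : ‖(inner ℂ v e / (B : ℂ) ^ 2 : ℂ)‖ = a / B ^ 2 := by
    rw [norm_div, norm_pow, Complex.norm_real, Real.norm_of_nonneg hB.le, norm_inner_symm]
  -- The optimal coefficient with ‖v‖² replaced by its bound B²: its modulus is at most 1 and it
  -- lowers ‖e‖² by at least |⟨e, v⟩|²/B².
  have h1 := h (inner ℂ v e / (B : ℂ) ^ 2) (by
    rw [hnorm, div_le_one (by positivity)]
    exact haB)
  rw [norm_sub_sq (𝕜 := ℂ), inner_smul_right, norm_smul, hnorm] at h1
  have h2 : RCLike.re ((inner ℂ v e / (B : ℂ) ^ 2) * inner ℂ e v : ℂ) = a ^ 2 / B ^ 2 := by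
    have h3 : (inner ℂ v e / (B : ℂ) ^ 2) * inner ℂ e v = ((a ^ 2 / B ^ 2 : ℝ) : ℂ) := by
      rw [div_mul_eq_mul_div, ← inner_conj_symm v e, Complex.conj_mul']
      push_cast
      rfl
    rw [h3]
    exact Complex.ofReal_re _
  rw [h2] at h1
  have h4 : (a / B ^ 2 * ‖v‖) ^ 2 ≤ a ^ 2 / B ^ 2 := by
    calc (a / B ^ 2 * ‖v‖) ^ 2 ≤ (a / B ^ 2 * B) ^ 2 := by gcongr
      _ = a ^ 2 / B ^ 2 := by field_simp
  have h5 : a ^ 2 / B ^ 2 ≤ ε ^ 2 / B ^ 2 := by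
    rw [div_pow] at h1
    linarith
  have h6 : a ^ 2 ≤ ε ^ 2 := (div_le_div_iff_of_pos_right (by positivity)).1 h5
  exact le_of_sq_le_sq h6 hε

/-- As long as stationarity fails, a further step lowers ‖c - v‖² by more than η, so N steps would
make it negative. This replaces the orthogonal projection onto the span of the translates of x by a
process whose length is bounded in advance. -/
theorem exists_stationary {H : Type v} [NormedAddCommGroup H] [InnerProductSpace ℂ H]
    (π : UnitaryRep G H) {K : Type w} [NormedAddCommGroup K] [InnerProductSpace ℂ K]
    (ρ : UnitaryRep G K) {m : ℕ} (x : Fin m → H) (y : Fin m → K) (F : Finset G) (c : H) {η : ℝ}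
    (hη : 0 < η) {N : ℕ} (hN : ‖c‖ ^ 2 < N * η) :
    ∃ k ≤ N, ∃ v w, Reach F π ρ x y k v w ∧ ‖c - v‖ ≤ ‖c‖ ∧ ∀ g ∈ F, ∀ b, ∀ t : ℂ, ‖t‖ ≤ 1 →
      ‖c - v‖ ^ 2 - η ≤ ‖c - v - t • π g ((Matrix.vecCons v x : Fin (m + 1) → H) b)‖ ^ 2 := by
  by_contra! hcon
  have key : ∀ k ≤ N, ∃ v w, Reach F π ρ x y k v w ∧ ‖c - v‖ ^ 2 ≤ ‖c‖ ^ 2 - k * η := by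
    intro k
    induction k with
    | zero => exact fun _ => ⟨0, 0, .zero, by simp⟩
    | succ k ih =>
      intro hk
      obtain ⟨v, w, hr, hv⟩ := ih (by omega)
      have hle : ‖c - v‖ ≤ ‖c‖ := by
        refine le_of_sq_le_sq (hv.trans ?_) (norm_nonneg _)
        have : 0 ≤ (k : ℝ) * η := by positivity
        linarith
      obtain ⟨g, hg, b, t, ht, hlt⟩ := hcon k (by omega) v w hr hle
      refine ⟨_, _, hr.step hg ht b, ?_⟩
      rw [← sub_sub]
      push_cast
      linarith
  obtain ⟨v, w, -, hv⟩ := key N le_rfl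
  have := sq_nonneg ‖c - v‖
  linarith

/-- The extension property: if two tuples are sufficiently close, every bounded extension of the
first one is matched by an extension of the second one in a model of `Σ_G⁻`. -/
theorem exists_extension (hG : IsAmenable G) (m : ℕ) (F : Finset G) {ε r r' R : ℝ} (hε : 0 < ε)
    (hr : 0 < r) (hrr' : r < r') : ∃ (F' : Finset G) (δ : ℝ), 0 < δ ∧
      ∀ {H : Type v} [NormedAddCommGroup H] [InnerProductSpace ℂ H] (π : UnitaryRep G H)
        {K : Type w} [NormedAddCommGroup K] [InnerProductSpace ℂ K] [CompleteSpace K]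
        (ρ : UnitaryRep G K), IsModel (ofRep ρ) (sigmaGMinus G) →
        ∀ (x : Fin m → H) (y : Fin m → K), (∀ i, ‖x i‖ ≤ R) → Close F' δ π ρ x y →
        ∀ c : H, ‖c‖ ≤ r → ∃ d : K, ‖d‖ ≤ r' ∧
          Close F ε π ρ (Matrix.vecCons c x) (Matrix.vecCons d y) := by
  classical
  open scoped Pointwise in
  let F₁ : Finset G := insert 1 (F ∪ F⁻¹)
  have hF₁ : 1 ∈ F₁ := Finset.mem_insert_self _ _
  have hF₁inv : ∀ g ∈ F₁, g⁻¹ ∈ F₁ := by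
    intro g hg
    simpa [F₁, or_comm] using hg
  have hFF₁ : F ⊆ F₁ := Finset.subset_union_left.trans (Finset.subset_insert _ _)
  -- The second bound turns closeness at the identity into ‖d‖² ≤ r² + ε₀ ≤ r'².
  set ε₀ : ℝ := min ε (r' ^ 2 - r ^ 2) with hε₀
  have hε₀pos : 0 < ε₀ := lt_min hε (by nlinarith)
  -- Expanding ⟨v + e, g(v + e)⟩ against ⟨w + e', g(w + e')⟩ leaves six errors: v against w, four
  -- cross terms, and e against e'.
  set ε₁ : ℝ := ε₀ / 6 with hε₁
  have hε₁pos : 0 < ε₁ := by positivity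
  -- A common bound for ‖x_i‖ ≤ R, ‖e‖ ≤ r and ‖v‖ ≤ 2r.
  let B : ℝ := |R| + 2 * r + 1
  have hB : 0 < B := by positivity
  obtain ⟨N, hN⟩ := exists_nat_gt (r ^ 2 / (ε₁ / B) ^ 2)
  obtain ⟨F', δ, hδ, hclose⟩ := exists_close_of_reach_le.{u, v, w} m hF₁ N F₁ hε₁pos
  refine ⟨F', δ, hδ, fun {H} _ _ π {K} _ _ _ ρ hρ x y hx hxy c hc => ?_⟩
  obtain ⟨k, hk, v, w, hreach, hle, hstat⟩ :=
    exists_stationary π ρ x y F₁ c (η := (ε₁ / B) ^ 2) (by positivity) (N := N) (by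
      rw [div_lt_iff₀ (by positivity)] at hN
      refine lt_of_le_of_lt ?_ hN
      gcongr)
  have hvw := hclose π ρ x y hxy k hk v w hreach
  obtain ⟨e, he⟩ : ∃ e, e = c - v := ⟨_, rfl⟩
  have hcv : c = v + e := by rw [he]; abel
  rw [← he] at hle
  have hvnorm : ‖v‖ ≤ 2 * r := by
    have : v = c - e := by rw [he]; abel
    rw [this]
    exact (norm_sub_le _ _).trans (by linarith)
  have horth : ∀ g ∈ F₁, ∀ b : Fin (m + 1),
      ‖(inner ℂ e (π g ((Matrix.vecCons v x : Fin (m + 1) → H) b)) : ℂ)‖ ≤ ε₁ := by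
    intro g hg b
    refine norm_inner_le_of_stationary hB hε₁pos.le ?_ ?_ ?_
    · have := abs_nonneg R
      linarith
    · rw [(π g).norm_map]
      refine Fin.cases ?_ (fun i => ?_) b
      · have := abs_nonneg R
        change ‖v‖ ≤ _
        linarith
      · have := le_abs_self R
        change ‖x i‖ ≤ _
        linarith [hx i]
    · intro t ht
      have := hstat g hg b t ht
      rwa [← he] at this
  -- The counterpart of c will be w + e': w copies the steps that built v, and e' copies the
  -- remainder.
  obtain ⟨e', he', horth'⟩ := exists_approx_copy hG π e ρ hρ F₁
    (fun p : F₁ × Fin (m + 1) => ρ p.1 ((Matrix.vecCons w y : Fin (m + 1) → K) p.2)) hε₁pos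
  replace horth' : ∀ g ∈ F₁, ∀ b : Fin (m + 1),
      ‖(inner ℂ e' (ρ g ((Matrix.vecCons w y : Fin (m + 1) → K) b)) : ℂ)‖ ≤ ε₁ :=
    fun g hg b => horth' (⟨g, hg⟩, b)
  have horthl : ∀ g ∈ F₁, ∀ b : Fin (m + 1),
      ‖(inner ℂ ((Matrix.vecCons v x : Fin (m + 1) → H) b) (π g e) : ℂ)‖ ≤ ε₁ := by
    intro g hg b
    rw [inner_act_left, norm_star]
    exact horth _ (hF₁inv g hg) b
  have horthl' : ∀ g ∈ F₁, ∀ b : Fin (m + 1),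
      ‖(inner ℂ ((Matrix.vecCons w y : Fin (m + 1) → K) b) (ρ g e') : ℂ)‖ ≤ ε₁ := by
    intro g hg b
    rw [inner_act_left, norm_star]
    exact horth' _ (hF₁inv g hg) b
  have hcd : Close F₁ ε₀ π ρ (Matrix.vecCons c x) (Matrix.vecCons (w + e') y) := by
    refine Close.cons hF₁inv (hvw.tail.mono subset_rfl (by linarith)) ?_ ?_
    · intro g hg
      have h0 := hvw 0 0 g hg
      have h1 := horthl g hg 0
      have h2 := horth g hg 0
      have h3 := horthl' g hg 0
      have h4 := horth' g hg 0
      simp only [Matrix.cons_val_zero] at h0 h1 h2 h3 h4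
      have h5 : (inner ℂ c (π g c) - inner ℂ (w + e') (ρ g (w + e')) : ℂ) =
          (inner ℂ v (π g v) - inner ℂ w (ρ g w)) + inner ℂ v (π g e) + inner ℂ e (π g v) -
          inner ℂ w (ρ g e') - inner ℂ e' (ρ g w) +
          (inner ℂ e (π g e) - inner ℂ e' (ρ g e')) := by
        rw [hcv]
        simp only [map_add, inner_add_left, inner_add_right]
        ring
      rw [h5]
      refine (norm_add_le _ _).trans ?_
      refine (add_le_add_left ((norm_sub_le _ _).trans (add_le_add_left
        ((norm_sub_le _ _).trans (add_le_add_left (norm_add₃_le) _)) _)) _).trans ?_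
      linarith [he' g hg]
    · intro i g hg
      have h0 := hvw i.succ 0 g hg
      have h1 := horthl g hg i.succ
      have h3 := horthl' g hg i.succ
      simp only [Matrix.cons_val_zero, Matrix.cons_val_succ] at h0 h1 h3
      have h5 : (inner ℂ (x i) (π g c) - inner ℂ (y i) (ρ g (w + e')) : ℂ) =
          (inner ℂ (x i) (π g v) - inner ℂ (y i) (ρ g w)) + inner ℂ (x i) (π g e) -
          inner ℂ (y i) (ρ g e') := by
        rw [hcv]
        simp only [map_add, inner_add_right]
        ring
      rw [h5]
      refine (norm_sub_le _ _).trans ((add_le_add_left (norm_add_le _ _) _).trans ?_)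
      linarith
  refine ⟨w + e', ?_, hcd.mono hFF₁ (min_le_left _ _)⟩
  have h1 := hcd 0 0 1 hF₁
  simp only [Matrix.cons_val_zero, map_one, LinearIsometryEquiv.coe_one, id_eq] at h1
  rw [inner_self_eq_norm_sq_to_K, inner_self_eq_norm_sq_to_K] at h1
  have h2 : |‖c‖ ^ 2 - ‖w + e'‖ ^ 2| ≤ ε₀ := by
    rw [← Real.norm_eq_abs, ← Complex.norm_real]
    push_cast
    exact h1
  have h3 := (abs_le.1 h2).1
  have h4 : ε₀ ≤ r' ^ 2 - r ^ 2 := min_le_right _ _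
  have h5 : ‖c‖ ^ 2 ≤ r ^ 2 := by gcongr
  exact le_of_sq_le_sq (by linarith) (by linarith)

end Extension

/-! ### Quantifier-free types -/

section Types

/-- The space of quantifier-free types of tuples of `m` vectors and `n` scalars. -/
abbrev TypeSpace (G : Type u) (m n : ℕ) : Type u := (Fin m × Fin m × G) ⊕ Fin n → ℂ

/-- The quantifier-free type of a tuple. -/
def qfType {G : Type u} [Group G] {H : Type v} [NormedAddCommGroup H] [InnerProductSpace ℂ H]
    (π : UnitaryRep G H) {m n : ℕ} (x : Fin m → H) (z : Fin n → ℂ) : TypeSpace G m n :=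
  Sum.elim (fun p => inner ℂ (x p.1) (π p.2.2 (x p.2.1))) z

/-- Linear combinations of translates of variables, with coefficients that depend on the
quantifier-free type. -/
abbrev VecForm (G : Type u) (m n : ℕ) : Type u := List (G × Fin m × (TypeSpace G m n → ℂ))

/-- The value of a linear combination of translates. -/
def VecForm.value {G : Type u} [Group G] {H : Type v} [NormedAddCommGroup H]
    [InnerProductSpace ℂ H] (π : UnitaryRep G H) {m n : ℕ} (x : Fin m → H) (τ : TypeSpace G m n)
    (l : VecForm G m n) : H :=
  (l.map fun p => p.2.2 τ • π p.1 (x p.2.1)).sum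

/-- The inner product of two linear combinations of translates. -/
def VecForm.pairing {G : Type u} [Group G] {m n : ℕ} (l l' : VecForm G m n) (τ : TypeSpace G m n) :
    ℂ :=
  (l.map fun p => (l'.map fun p' =>
    star (p.2.2 τ) * (p'.2.2 τ * τ (.inl (p.2.1, p'.2.1, p.1⁻¹ * p'.1)))).sum).sum

variable {G : Type u} [Group G] {m n : ℕ}

theorem VecForm.inner_value_value {H : Type v} [NormedAddCommGroup H]
    [InnerProductSpace ℂ H] (π : UnitaryRep G H) (x : Fin m → H) (z : Fin n → ℂ)
    (l l' : VecForm G m n) :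
    (inner ℂ (l.value π x (qfType π x z)) (l'.value π x (qfType π x z)) : ℂ) =
      l.pairing l' (qfType π x z) := by
  induction l with
  | nil => simp [VecForm.value, VecForm.pairing]
  | cons p l ih =>
    simp only [VecForm.value, VecForm.pairing, List.map_cons, List.sum_cons] at ih ⊢
    rw [inner_add_left, ih]
    congr 1
    clear ih
    induction l' with
    | nil => simp
    | cons p' l' ih =>
      simp only [List.map_cons, List.sum_cons]
      rw [inner_add_right, ih, inner_smul_left, inner_smul_right, inner_act_act]
      rfl

theorem VecForm.continuous_pairing {l l' : VecForm G m n} (hl : ∀ p ∈ l, Continuous p.2.2)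
    (hl' : ∀ p ∈ l', Continuous p.2.2) : Continuous (l.pairing l') := by
  refine continuous_list_sum l fun p hp => continuous_list_sum l' fun p' hp' => ?_
  have := hl p hp
  have := hl' p' hp'
  fun_prop

/-- The values of terms as functions of the quantifier-free type. -/
abbrev NormalForm (G : Type u) (m n : ℕ) : Srt → Type u
  | .vec => VecForm G m n
  | .scal => TypeSpace G m n → ℂ

/-- The normal form of a term. -/
def Term.normalForm : {s : Srt} → Term G m n s → NormalForm G m n s
  | _, .vvar i => [(1, i, fun _ => 1)]
  | _, .vzero => []
  | _, .vadd s t => List.append s.normalForm t.normalForm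
  | _, .vsmul a s => List.map (fun p => (p.1, p.2.1, fun τ => a.normalForm τ * p.2.2 τ)) s.normalForm
  | _, .vact g s => List.map (fun p => (g * p.1, p.2)) s.normalForm
  | _, .svar j => fun τ => τ (.inr j)
  | _, .srat q => fun _ => q
  | _, .simag => fun _ => Complex.I
  | _, .sadd a b => fun τ => a.normalForm τ + b.normalForm τ
  | _, .smul a b => fun τ => a.normalForm τ * b.normalForm τ
  | _, .sconj a => fun τ => star (a.normalForm τ)
  | _, .sinner s t => VecForm.pairing s.normalForm t.normalForm
  -- At points that are not types of tuples the pairing may be negative or non-real; the total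
  -- function `√` of its real part is still continuous there.
  | _, .snorm s => fun τ => ((√(VecForm.pairing s.normalForm s.normalForm τ).re : ℝ) : ℂ)

theorem Term.continuous_normalForm {s : Srt} (t : Term G m n s) :
    match s, t with
    | .vec, t => ∀ p ∈ t.normalForm, Continuous p.2.2
    | .scal, t => Continuous t.normalForm := by
  induction t with
  | vvar i =>
    intro p hp
    obtain rfl := List.mem_singleton.1 hp
    exact continuous_const
  | vzero => intro p hp; exact absurd hp List.not_mem_nil
  | vadd s t ihs iht => exact fun p hp => (List.mem_append.1 hp).elim (ihs p) (iht p)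
  | vsmul a s iha ihs =>
    intro p hp
    obtain ⟨p', hp', rfl⟩ := List.mem_map.1 hp
    exact iha.mul (ihs p' hp')
  | vact g s ihs =>
    intro p hp
    obtain ⟨p', hp', rfl⟩ := List.mem_map.1 hp
    exact ihs p' hp'
  | svar j => exact continuous_apply _
  | srat q => exact continuous_const
  | simag => exact continuous_const
  | sadd a b iha ihb => exact iha.add ihb
  | smul a b iha ihb => exact iha.mul ihb
  | sconj a iha => exact iha.star
  | sinner s t ihs iht => exact VecForm.continuous_pairing ihs iht
  | snorm s ihs =>
    exact Complex.continuous_ofReal.comp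
      (Real.continuous_sqrt.comp (Complex.continuous_re.comp (VecForm.continuous_pairing ihs ihs)))

theorem Term.eval_eq_normalForm {H : Type v} [NormedAddCommGroup H]
    [InnerProductSpace ℂ H] [CompleteSpace H] (π : UnitaryRep G H) (x : Fin m → H)
    (z : Fin n → ℂ) {s : Srt} (t : Term G m n s) :
    match s, t with
    | .vec, t => t.vector (ofRep π) x z = VecForm.value π x (qfType π x z) t.normalForm
    | .scal, t => t.scalar (ofRep π) x z = t.normalForm (qfType π x z) := by
  induction t with
  | vvar i => simp [Term.normalForm, VecForm.value]
  | vzero => simp [Term.normalForm, VecForm.value]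
  | vadd s t ihs iht =>
    dsimp only at *
    rw [Term.vector_vadd, ihs, iht]
    exact ((congrArg List.sum List.map_append).trans List.sum_append).symm
  | vsmul a s iha ihs =>
    dsimp only at *
    rw [Term.vector_vsmul, iha, ihs, VecForm.value, VecForm.value, List.smul_sum]
    simp only [Term.normalForm, List.map_map]
    congr 1
    refine List.map_congr_left fun p _ => ?_
    simp [mul_smul]
  | vact g s ihs =>
    dsimp only at *
    rw [Term.vector_vact, ihs]
    change π g _ = _
    rw [VecForm.value, VecForm.value, map_list_sum]
    simp only [Term.normalForm, List.map_map]
    congr 1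
    refine List.map_congr_left fun p _ => ?_
    simp
  | svar j => rfl
  | srat q => rfl
  | simag => rfl
  | sadd a b iha ihb => dsimp only at *; rw [Term.scalar_sadd, iha, ihb]; rfl
  | smul a b iha ihb => dsimp only at *; rw [Term.scalar_smul, iha, ihb]; rfl
  | sconj a iha => dsimp only at *; rw [Term.scalar_sconj, iha]; rfl
  | sinner s t ihs iht =>
    dsimp only at *
    rw [Term.scalar_sinner, ihs, iht]
    exact VecForm.inner_value_value π x z _ _
  | snorm s ihs =>
    dsimp only at *
    rw [Term.scalar_snorm, ihs]
    have h := VecForm.inner_value_value π x z s.normalForm s.normalForm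
    have h' : (VecForm.pairing s.normalForm s.normalForm (qfType π x z)).re =
        ‖VecForm.value π x (qfType π x z) s.normalForm‖ ^ 2 := by
      rw [← h]
      exact inner_self_eq_norm_sq (𝕜 := ℂ) _
    simp only [Term.normalForm]
    rw [h', Real.sqrt_sq (norm_nonneg _)]

/-- An entourage of a product restricts only finitely many coordinates. This is why finitely many
group elements suffice. -/
theorem exists_finset_of_mem_uniformity {ι : Type u} {U : Set ((ι → ℂ) × (ι → ℂ))}
    (hU : U ∈ uniformity (ι → ℂ)) : ∃ (s : Finset ι) (δ : ℝ), 0 < δ ∧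
      ∀ a b : ι → ℂ, (∀ i ∈ s, ‖a i - b i‖ ≤ δ) → (a, b) ∈ U := by
  classical
  rw [Pi.uniformity] at hU
  refine Filter.iInf_sets_induct hU ?_ ?_
  · exact ⟨∅, 1, one_pos, fun _ _ _ => trivial⟩
  · intro i U₁ U₂ h₁ h₂
    obtain ⟨s, δ, hδ, h⟩ := h₂
    obtain ⟨V, hV, hVU⟩ := h₁
    obtain ⟨ε, hε, hεV⟩ := Metric.mem_uniformity_dist.1 hV
    refine ⟨insert i s, min (ε / 2) δ, by positivity, fun a b hab => ⟨hVU (hεV ?_), h a b ?_⟩⟩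
    · rw [dist_eq_norm]
      exact (hab i (Finset.mem_insert_self _ _)).trans_lt
        ((min_le_left _ _).trans_lt (by linarith))
    · exact fun j hj => (hab j (Finset.mem_insert_of_mem hj)).trans (min_le_right _ _)

/-- Scalars are bounded by R and coefficients by R². The types of bounded tuples lie in a product of
discs, compact by Tychonoff. -/
theorem qfType_mem_pi_closedBall {H : Type v} [NormedAddCommGroup H] [InnerProductSpace ℂ H]
    (π : UnitaryRep G H) {x : Fin m → H} {z : Fin n → ℂ} {R : ℝ} (hx : ∀ i, ‖x i‖ ≤ R)
    (hz : ∀ j, ‖z j‖ ≤ R) :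
    qfType π x z ∈ Set.pi Set.univ fun _ => Metric.closedBall (0 : ℂ) (max R (R ^ 2)) := by
  rintro (⟨i, j, g⟩ | j) -
  · rw [mem_closedBall_zero_iff]
    refine (norm_inner_le_norm (x i) (π g (x j))).trans (le_trans ?_ (le_max_right _ _))
    rw [(π g).norm_map, sq]
    exact mul_le_mul (hx i) (hx j) (norm_nonneg _) ((norm_nonneg _).trans (hx i))
  · rw [mem_closedBall_zero_iff]
    exact (hz j).trans (le_max_left _ _)

/-- Terms are uniformly continuous with respect to closeness of bounded tuples. -/
theorem Term.exists_close (t : Term G m n .scal) (R : ℝ) {ε : ℝ} (hε : 0 < ε) :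
    ∃ (F : Finset G) (δ : ℝ), 0 < δ ∧
      ∀ {H : Type v} [NormedAddCommGroup H] [InnerProductSpace ℂ H] [CompleteSpace H]
        (π : UnitaryRep G H) {K : Type w} [NormedAddCommGroup K] [InnerProductSpace ℂ K]
        [CompleteSpace K] (ρ : UnitaryRep G K) (x : Fin m → H) (y : Fin m → K) (z z' : Fin n → ℂ),
        (∀ i, ‖x i‖ ≤ R) → (∀ i, ‖y i‖ ≤ R) → (∀ j, ‖z j‖ ≤ R) → (∀ j, ‖z' j‖ ≤ R) →
        Close F δ π ρ x y → (∀ j, ‖z j - z' j‖ ≤ δ) →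
          ‖t.scalar (ofRep π) x z - t.scalar (ofRep ρ) y z'‖ < ε := by
  classical
  have hB : IsCompact (Set.pi Set.univ fun _ : (Fin m × Fin m × G) ⊕ Fin n =>
      Metric.closedBall (0 : ℂ) (max R (R ^ 2))) :=
    isCompact_univ_pi fun _ => isCompact_closedBall _ _
  have hcont : Continuous (t.normalForm : TypeSpace G m n → ℂ) := t.continuous_normalForm
  -- Heine–Cantor on the compact set of bounded types makes one choice of F and δ valid in all
  -- representations.
  have hunif := hB.uniformContinuousOn_of_continuous hcont.continuousOn
  have hU := hunif (Metric.dist_mem_uniformity hε)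
  rw [Filter.mem_map, Filter.mem_inf_principal] at hU
  obtain ⟨s, δ, hδ, hs⟩ := exists_finset_of_mem_uniformity hU
  refine ⟨s.biUnion (Sum.elim (fun p => {p.2.2}) fun _ => ∅), δ, hδ,
    fun {H} _ _ _ π {K} _ _ _ ρ x y z z' hx hy hz hz' hclose hzz => ?_⟩
  have h1 : t.scalar (ofRep π) x z = t.normalForm (qfType π x z) := t.eval_eq_normalForm π x z
  have h2 : t.scalar (ofRep ρ) y z' = t.normalForm (qfType ρ y z') := t.eval_eq_normalForm ρ y z'
  rw [h1, h2, ← dist_eq_norm]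
  refine hs (qfType π x z) (qfType ρ y z') ?_
    ⟨qfType_mem_pi_closedBall π hx hz, qfType_mem_pi_closedBall ρ hy hz'⟩
  rintro (⟨i, j, g⟩ | j) hp
  · exact hclose i j g (Finset.mem_biUnion.2 ⟨_, hp, by simp⟩)
  · exact hzz j

end Types

/-! ### Transfer of formulas between models -/

section Transfer

variable {G : Type u} [Group G]

/-- Satisfaction of `φ` by a tuple in a model of `Σ_G⁻` implies satisfaction of `φ'` by all close
tuples in models of `Σ_G⁻`, for tuples bounded by `R`. -/
def Transfers (F : Finset G) (δ R : ℝ) {m n : ℕ} (φ φ' : Formula G m n) : Prop :=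
  ∀ (H : Type v) [NormedAddCommGroup H] [InnerProductSpace ℂ H] [CompleteSpace H]
    (π : UnitaryRep G H) (K : Type w) [NormedAddCommGroup K] [InnerProductSpace ℂ K]
    [CompleteSpace K] (ρ : UnitaryRep G K), IsModel (ofRep π) (sigmaGMinus G) →
    IsModel (ofRep ρ) (sigmaGMinus G) →
    ∀ (x : Fin m → H) (y : Fin m → K) (z z' : Fin n → ℂ),
      (∀ i, ‖x i‖ ≤ R) → (∀ i, ‖y i‖ ≤ R) → (∀ j, ‖z j‖ ≤ R) → (∀ j, ‖z' j‖ ≤ R) →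
      Close F δ π ρ x y → (∀ j, ‖z j - z' j‖ ≤ δ) →
        φ.Realize (ofRep π) x z → φ'.Realize (ofRep ρ) y z'

theorem Transfers.mono {F F' : Finset G} {δ δ' R : ℝ} {m n : ℕ} {φ φ' : Formula G m n}
    (h : Transfers.{u, v, w} F δ R φ φ') (hF : F ⊆ F') (hδ : δ' ≤ δ) :
    Transfers.{u, v, w} F' δ' R φ φ' :=
  fun H _ _ _ π K _ _ _ ρ hπ hρ x y z z' hx hy hz hz' hxy hzz => h H π K ρ hπ hρ x y z z' hx hy hz hz'
    (hxy.mono hF hδ) fun j => (hzz j).trans hδ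

theorem norm_vecCons_le {E : Type v} [Norm E] {m : ℕ} {c : E} {x : Fin m → E} {R : ℝ}
    (hc : ‖c‖ ≤ R) (hx : ∀ i, ‖x i‖ ≤ R) (i : Fin (m + 1)) :
    ‖(Matrix.vecCons c x : Fin (m + 1) → E) i‖ ≤ R :=
  Fin.cases hc hx i

theorem norm_vecCons_sub_le {n : ℕ} (c : ℂ) {z z' : Fin n → ℂ} {δ : ℝ} (hδ : 0 ≤ δ)
    (h : ∀ j, ‖z j - z' j‖ ≤ δ) (j : Fin (n + 1)) :
    ‖(Matrix.vecCons c z : Fin (n + 1) → ℂ) j - (Matrix.vecCons c z' : Fin (n + 1) → ℂ) j‖ ≤ δ :=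
  Fin.cases (by simpa using hδ) h j

/-- Induction on the approximation, which provides slack at each level: p < p' absorbs the variation
of a term, and r < r' absorbs the growth of the norm in the extension property. -/
theorem exists_transfers (hG : IsAmenable G) {m n : ℕ} {φ φ' : Formula G m n}
    (h : φ.Approx φ') (R : ℝ) :
    ∃ (F : Finset G) (δ : ℝ), 0 < δ ∧ Transfers.{u, v, w} F δ R φ φ' := by
  classical
  induction h generalizing R with
  | @le m n t p p' h =>
    obtain ⟨F, δ, hδ, H'⟩ := t.exists_close.{u, v, w} R (ε := (p' : ℝ) - p)
      (sub_pos.2 (by exact_mod_cast h))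
    refine ⟨F, δ, hδ, fun H _ _ _ π K _ _ _ ρ hπ hρ x y z z' hx hy hz hz' hxy hzz hφ => ?_⟩
    have h1 := H' π ρ x y z z' hx hy hz hz' hxy hzz
    have h2 := (abs_le.1 ((Complex.abs_re_le_norm _).trans h1.le)).1
    rw [Complex.sub_re] at h2
    have h3 : (t.scalar (ofRep π) x z).re ≤ (p : ℝ) := hφ
    change (t.scalar (ofRep ρ) y z').re ≤ (p' : ℝ)
    linarith
  | @ge m n t p p' h =>
    obtain ⟨F, δ, hδ, H'⟩ := t.exists_close.{u, v, w} R (ε := (p : ℝ) - p')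
      (sub_pos.2 (by exact_mod_cast h))
    refine ⟨F, δ, hδ, fun H _ _ _ π K _ _ _ ρ hπ hρ x y z z' hx hy hz hz' hxy hzz hφ => ?_⟩
    have h1 := H' π ρ x y z z' hx hy hz hz' hxy hzz
    have h2 := (abs_le.1 ((Complex.abs_re_le_norm _).trans h1.le)).2
    rw [Complex.sub_re] at h2
    have h3 : (p : ℝ) ≤ (t.scalar (ofRep π) x z).re := hφ
    change (p' : ℝ) ≤ (t.scalar (ofRep ρ) y z').re
    linarith
  | and _ _ ih ih' =>
    obtain ⟨F₁, δ₁, hδ₁, H₁⟩ := ih R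
    obtain ⟨F₂, δ₂, hδ₂, H₂⟩ := ih' R
    have H₁ := H₁.mono (Finset.subset_union_left (s₂ := F₂)) (min_le_left δ₁ δ₂)
    have H₂ := H₂.mono (Finset.subset_union_right (s₁ := F₁)) (min_le_right δ₁ δ₂)
    exact ⟨_, _, lt_min hδ₁ hδ₂, fun H _ _ _ π K _ _ _ ρ hπ hρ x y z z' hx hy hz hz' hxy hzz =>
      And.imp (H₁ H π K ρ hπ hρ x y z z' hx hy hz hz' hxy hzz)
        (H₂ H π K ρ hπ hρ x y z z' hx hy hz hz' hxy hzz)⟩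
  | or _ _ ih ih' =>
    obtain ⟨F₁, δ₁, hδ₁, H₁⟩ := ih R
    obtain ⟨F₂, δ₂, hδ₂, H₂⟩ := ih' R
    have H₁ := H₁.mono (Finset.subset_union_left (s₂ := F₂)) (min_le_left δ₁ δ₂)
    have H₂ := H₂.mono (Finset.subset_union_right (s₁ := F₁)) (min_le_right δ₁ δ₂)
    exact ⟨_, _, lt_min hδ₁ hδ₂, fun H _ _ _ π K _ _ _ ρ hπ hρ x y z z' hx hy hz hz' hxy hzz =>
      Or.imp (H₁ H π K ρ hπ hρ x y z z' hx hy hz hz' hxy hzz)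
        (H₂ H π K ρ hπ hρ x y z z' hx hy hz hz' hxy hzz)⟩
  | @exV m n r r' φ φ' hr _ ih =>
    obtain ⟨F₁, δ₁, hδ₁, H₁⟩ := ih (max R ((r' : ℚ) : ℝ))
    have hr0 : (0 : ℝ) < ((r : ℚ) : ℝ) := by exact_mod_cast r.2
    have hrr : ((r : ℚ) : ℝ) < ((r' : ℚ) : ℝ) := by exact_mod_cast hr
    obtain ⟨F₂, δ₂, hδ₂, H₂⟩ := exists_extension.{u, v, w} hG m F₁ (R := R) hδ₁ hr0 hrr
    refine ⟨F₂, min δ₁ δ₂, lt_min hδ₁ hδ₂,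
      fun H _ _ _ π K _ _ _ ρ hπ hρ x y z z' hx hy hz hz' hxy hzz => ?_⟩
    rintro ⟨c, hc, hφ⟩
    obtain ⟨d, hd, hcd⟩ :=
      H₂ π ρ hρ x y hx (hxy.mono subset_rfl (min_le_right _ _)) c hc
    refine ⟨d, hd, H₁ H π K ρ hπ hρ _ _ z z' ?_ ?_ ?_ ?_ hcd ?_ hφ⟩
    · exact norm_vecCons_le ((hc.trans hrr.le).trans (le_max_right _ _))
        fun i => (hx i).trans (le_max_left _ _)
    · exact norm_vecCons_le (hd.trans (le_max_right _ _)) fun i => (hy i).trans (le_max_left _ _)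
    · exact fun j => (hz j).trans (le_max_left _ _)
    · exact fun j => (hz' j).trans (le_max_left _ _)
    · exact fun j => (hzz j).trans (min_le_left _ _)
  | @allV m n r r' φ φ' hr _ ih =>
    obtain ⟨F₁, δ₁, hδ₁, H₁⟩ := ih (max R ((r : ℚ) : ℝ))
    have hr0 : (0 : ℝ) < ((r' : ℚ) : ℝ) := by exact_mod_cast r'.2
    have hrr : ((r' : ℚ) : ℝ) < ((r : ℚ) : ℝ) := by exact_mod_cast hr
    -- For a universal quantifier the extension goes backwards: a vector of K is matched in H, where
    -- φ holds for all vectors of the larger ball.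
    obtain ⟨F₂, δ₂, hδ₂, H₂⟩ := exists_extension.{u, w, v} hG m F₁ (R := R) hδ₁ hr0 hrr
    refine ⟨F₂, min δ₁ δ₂, lt_min hδ₁ hδ₂,
      fun H _ _ _ π K _ _ _ ρ hπ hρ x y z z' hx hy hz hz' hxy hzz hφ d hd => ?_⟩
    obtain ⟨c, hc, hcd⟩ :=
      H₂ ρ π hπ y x hy (hxy.symm.mono subset_rfl (min_le_right _ _)) d hd
    refine H₁ H π K ρ hπ hρ _ _ z z' ?_ ?_ ?_ ?_ hcd.symm ?_ (hφ c hc)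
    · exact norm_vecCons_le (hc.trans (le_max_right _ _)) fun i => (hx i).trans (le_max_left _ _)
    · exact norm_vecCons_le ((hd.trans hrr.le).trans (le_max_right _ _))
        fun i => (hy i).trans (le_max_left _ _)
    · exact fun j => (hz j).trans (le_max_left _ _)
    · exact fun j => (hz' j).trans (le_max_left _ _)
    · exact fun j => (hzz j).trans (min_le_left _ _)
  | @exS m n r r' φ φ' hr _ ih =>
    obtain ⟨F, δ, hδ, H'⟩ := ih (max R ((r' : ℚ) : ℝ))
    have hrr : ((r : ℚ) : ℝ) < ((r' : ℚ) : ℝ) := by exact_mod_cast hr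
    refine ⟨F, δ, hδ, fun H _ _ _ π K _ _ _ ρ hπ hρ x y z z' hx hy hz hz' hxy hzz => ?_⟩
    rintro ⟨c, hc, hφ⟩
    -- The scalar sort is ℂ in both structures, so the same scalar is a witness.
    refine ⟨c, hc.trans hrr.le, H' H π K ρ hπ hρ x y _ _ ?_ ?_ ?_ ?_ hxy
      (norm_vecCons_sub_le c hδ.le hzz) hφ⟩
    · exact fun i => (hx i).trans (le_max_left _ _)
    · exact fun i => (hy i).trans (le_max_left _ _)
    · exact norm_vecCons_le ((hc.trans hrr.le).trans (le_max_right _ _))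
        fun i => (hz i).trans (le_max_left _ _)
    · exact norm_vecCons_le ((hc.trans hrr.le).trans (le_max_right _ _))
        fun i => (hz' i).trans (le_max_left _ _)
  | @allS m n r r' φ φ' hr _ ih =>
    obtain ⟨F, δ, hδ, H'⟩ := ih (max R ((r : ℚ) : ℝ))
    have hrr : ((r' : ℚ) : ℝ) < ((r : ℚ) : ℝ) := by exact_mod_cast hr
    refine ⟨F, δ, hδ, fun H _ _ _ π K _ _ _ ρ hπ hρ x y z z' hx hy hz hz' hxy hzz hφ c hc => ?_⟩
    refine H' H π K ρ hπ hρ x y _ _ ?_ ?_ ?_ ?_ hxy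
      (norm_vecCons_sub_le c hδ.le hzz) (hφ c (hc.trans hrr.le))
    · exact fun i => (hx i).trans (le_max_left _ _)
    · exact fun i => (hy i).trans (le_max_left _ _)
    · exact norm_vecCons_le ((hc.trans hrr.le).trans (le_max_right _ _))
        fun i => (hz i).trans (le_max_left _ _)
    · exact norm_vecCons_le ((hc.trans hrr.le).trans (le_max_right _ _))
        fun i => (hz' i).trans (le_max_left _ _)

end Transfer

/-! ### Direct sums of two representations -/

section Prod

theorem prodLp_ext {H : Type v} {K : Type w} {p q : WithLp 2 (H × K)}
    (h : p.fst = q.fst) (h' : p.snd = q.snd) : p = q :=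
  WithLp.ofLp_injective 2 (Prod.ext h h')

variable {G : Type u} [Group G] {H : Type v} [NormedAddCommGroup H] [InnerProductSpace ℂ H]
  {K : Type w} [NormedAddCommGroup K] [InnerProductSpace ℂ K]

/-- The direct sum of two unitary operators. -/
def prodEquiv (U : H ≃ₗᵢ[ℂ] H) (V : K ≃ₗᵢ[ℂ] K) : WithLp 2 (H × K) ≃ₗᵢ[ℂ] WithLp 2 (H × K) where
  toFun p := WithLp.toLp 2 (U p.fst, V p.snd)
  invFun p := WithLp.toLp 2 (U.symm p.fst, V.symm p.snd)
  map_add' p q := prodLp_ext (by simp) (by simp)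
  map_smul' c p := prodLp_ext (by simp) (by simp)
  left_inv p := prodLp_ext (by simp) (by simp)
  right_inv p := prodLp_ext (by simp) (by simp)
  norm_map' p := by
    refine (sq_eq_sq₀ (norm_nonneg _) (norm_nonneg _)).1 ?_
    rw [WithLp.prod_norm_sq_eq_of_L2, WithLp.prod_norm_sq_eq_of_L2]
    simp

/-- The direct sum of two unitary representations. -/
def prodRep (π : UnitaryRep G H) (ρ : UnitaryRep G K) : UnitaryRep G (WithLp 2 (H × K)) where
  toFun g := prodEquiv (π g) (ρ g)
  map_one' := by ext p; exact prodLp_ext (by simp [prodEquiv]) (by simp [prodEquiv])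
  map_mul' g h := by ext p; exact prodLp_ext (by simp [prodEquiv]) (by simp [prodEquiv])

variable [CompleteSpace H] [CompleteSpace K]

/-- The embedding of the first summand. -/
def embeddingInl (π : UnitaryRep G H) (ρ : UnitaryRep G K) :
    Embedding (ofRep π) (ofRep (prodRep π ρ)) where
  toLinearIsometry :=
    { toFun := fun x => WithLp.toLp 2 (x, 0)
      map_add' := fun x y => prodLp_ext (by simp) (by simp)
      map_smul' := fun c x => prodLp_ext (by simp) (by simp)
      norm_map' := fun x => by
        refine (sq_eq_sq₀ (norm_nonneg _) (norm_nonneg _)).1 ?_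
        change ‖WithLp.toLp 2 (x, (0 : K))‖ ^ 2 = _
        rw [WithLp.prod_norm_sq_eq_of_L2]
        simp }
  map_ip x y := by
    change inner ℂ (WithLp.toLp 2 (x, (0 : K))) (WithLp.toLp 2 (y, (0 : K))) = inner ℂ x y
    simp
  map_act g x := by
    change WithLp.toLp 2 (π g x, (0 : K)) = prodEquiv (π g) (ρ g) (WithLp.toLp 2 (x, 0))
    simp [prodEquiv]

/-- The embedding of the second summand. -/
def embeddingInr (π : UnitaryRep G H) (ρ : UnitaryRep G K) :
    Embedding (ofRep ρ) (ofRep (prodRep π ρ)) where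
  toLinearIsometry :=
    { toFun := fun x => WithLp.toLp 2 (0, x)
      map_add' := fun x y => prodLp_ext (by simp) (by simp)
      map_smul' := fun c x => prodLp_ext (by simp) (by simp)
      norm_map' := fun x => by
        refine (sq_eq_sq₀ (norm_nonneg _) (norm_nonneg _)).1 ?_
        change ‖WithLp.toLp 2 ((0 : H), x)‖ ^ 2 = _
        rw [WithLp.prod_norm_sq_eq_of_L2]
        simp }
  map_ip x y := by
    change inner ℂ (WithLp.toLp 2 ((0 : H), x)) (WithLp.toLp 2 ((0 : H), y)) = inner ℂ x y
    simp
  map_act g x := by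
    change WithLp.toLp 2 ((0 : H), ρ g x) = prodEquiv (π g) (ρ g) (WithLp.toLp 2 (0, x))
    simp [prodEquiv]

end Prod

/-! ### Axiomatization -/

section Models

variable {G : Type u} [Group G]

/-- Existential sentences are preserved upwards along embeddings. -/
theorem isModel_sigmaGMinus_of_embedding {M : LGStructure.{u, v} G}
    (f : Embedding (inftyRegular G) M) : IsModel M (sigmaGMinus G) := by
  rintro σ' ⟨σ, ⟨hσ, hreal⟩, hσ'⟩
  refine Formula.Realize.approxRealize (hσ'.realize ?_)
  have h := f.realize_of_isExistential hσ hreal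
  rwa [Subsingleton.elim (fun i => f.toLinearIsometry ((![] : Fin 0 → _) i)) ![]] at h

theorem isModel_sigmaGMinus_inftyRegular : IsModel (inftyRegular G) (sigmaGMinus G) := by
  rintro σ' ⟨σ, ⟨-, hreal⟩, hσ'⟩
  exact Formula.Realize.approxRealize (hσ'.realize hreal)

theorem isModel_theoryTG_of_theoryTGA {M : LGStructure.{u, v} G} (hM : IsModel M (theoryTGA G)) :
    IsModel M (theoryTG G) :=
  fun σ hσ => hM σ (isModel_theoryTG_ofRep (inftyRegularRep G) σ hσ)

theorem isModel_sigmaGMinus_of_theoryTGA {M : LGStructure.{u, v} G}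
    (hM : IsModel M (theoryTGA G)) : IsModel M (sigmaGMinus G) :=
  fun σ hσ => hM σ (isModel_sigmaGMinus_inftyRegular σ hσ)

/-- A sentence has no free variables, so closeness is vacuous and transfer from ∞λ_G applies
outright. -/
theorem isModel_theoryTGA_of_sigmaGMinus (hG : IsAmenable G) {M : LGStructure.{u, v} G}
    (hM : IsModel M (theoryTG G)) (hM' : IsModel M (sigmaGMinus G)) :
    IsModel M (theoryTGA G) := by
  obtain ⟨H, _, _, _, π, rfl⟩ := exists_eq_ofRep hM
  intro σ hσ σ' hσ'
  obtain ⟨σ'', h1, h2⟩ := hσ'.exists_between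
  obtain ⟨F, δ, -, hT⟩ := exists_transfers.{u, u, v} hG h2 0
  exact hT _ (inftyRegularRep G) _ π isModel_sigmaGMinus_inftyRegular hM' ![] ![] ![] ![]
    (fun i => i.elim0) (fun i => i.elim0) (fun i => i.elim0) (fun i => i.elim0)
    (fun i => i.elim0) (fun i => i.elim0) (hσ σ'' h1)

theorem isModel_theoryTGA_iff (hG : IsAmenable G) :
    Axiomatizes.{u, v} (theoryTG G ∪ sigmaGMinus G) (theoryTGA G) := by
  intro M
  constructor
  · rintro hM σ (hσ | hσ)
    · exact isModel_theoryTG_of_theoryTGA hM σ hσ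
    · exact isModel_sigmaGMinus_of_theoryTGA hM σ hσ
  · exact fun hM => isModel_theoryTGA_of_sigmaGMinus hG (fun σ hσ => hM σ (.inl hσ))
      fun σ hσ => hM σ (.inr hσ)

/-! ### Model companion -/

/-- Tuples with equal coefficients are close for every F and δ, so no error remains to be
controlled. -/
theorem Formula.ApproxRealize.transfer (hG : IsAmenable G) {H : Type v} [NormedAddCommGroup H]
    [InnerProductSpace ℂ H] [CompleteSpace H] {π : UnitaryRep G H} {K : Type w}
    [NormedAddCommGroup K] [InnerProductSpace ℂ K] [CompleteSpace K] {ρ : UnitaryRep G K}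
    (hπ : IsModel (ofRep π) (sigmaGMinus G)) (hρ : IsModel (ofRep ρ) (sigmaGMinus G)) {m n : ℕ}
    {φ : Formula G m n} {x : Fin m → H} {y : Fin m → K} {z : Fin n → ℂ}
    (hxy : ∀ i j g, (inner ℂ (x i) (π g (x j)) : ℂ) = inner ℂ (y i) (ρ g (y j)))
    (h : φ.ApproxRealize (ofRep π) x z) : φ.ApproxRealize (ofRep ρ) y z := by
  intro φ' hφ'
  obtain ⟨φ'', h1, h2⟩ := hφ'.exists_between
  have hle : ∀ {k : ℕ} (a : Fin k → ℝ), (∀ i, 0 ≤ a i) → ∀ i, a i ≤ ∑ i, a i := fun a ha i =>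
    Finset.single_le_sum (fun i _ => ha i) (Finset.mem_univ i)
  let A : ℝ := ∑ i, ‖x i‖
  let B : ℝ := ∑ i, ‖y i‖
  let C : ℝ := ∑ i, ‖z i‖
  have hA : 0 ≤ A := Finset.sum_nonneg fun _ _ => norm_nonneg _
  have hB : 0 ≤ B := Finset.sum_nonneg fun _ _ => norm_nonneg _
  have hC : 0 ≤ C := Finset.sum_nonneg fun _ _ => norm_nonneg _
  have hx : ∀ i, ‖x i‖ ≤ A + B + C := fun i => by
    linarith [hle (fun i => ‖x i‖) (fun _ => norm_nonneg _) i]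
  have hy : ∀ i, ‖y i‖ ≤ A + B + C := fun i => by
    linarith [hle (fun i => ‖y i‖) (fun _ => norm_nonneg _) i]
  have hz : ∀ i, ‖z i‖ ≤ A + B + C := fun i => by
    linarith [hle (fun i => ‖z i‖) (fun _ => norm_nonneg _) i]
  obtain ⟨F, δ, hδ, hT⟩ := exists_transfers.{u, v, w} hG h2 (A + B + C)
  refine hT _ π _ ρ hπ hρ x y z z hx hy hz hz (fun i j g _ => ?_) (fun j => ?_) (h φ'' h1)
  · rw [hxy, sub_self, norm_zero]
    exact hδ.le
  · rw [sub_self, norm_zero]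
    exact hδ.le

theorem isModelComplete_theoryTGA (hG : IsAmenable G) :
    IsModelComplete.{u, v} (theoryTGA G) := by
  intro M N hM hN f m n φ x z
  obtain ⟨H, _, _, _, π, rfl⟩ := exists_eq_ofRep (isModel_theoryTG_of_theoryTGA hM)
  obtain ⟨K, _, _, _, ρ, rfl⟩ := exists_eq_ofRep (isModel_theoryTG_of_theoryTGA hN)
  have hxy : ∀ i j g, (inner ℂ (x i) (π g (x j)) : ℂ) =
      inner ℂ (f.toLinearIsometry (x i) : K) (ρ g (f.toLinearIsometry (x j))) := by
    intro i j g
    have h1 := f.map_act g (x j)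
    have h2 := f.map_ip (x i) (π g (x j))
    exact h2.symm.trans (congrArg (fun v : K => inner ℂ (f.toLinearIsometry (x i) : K) v) h1)
  exact ⟨Formula.ApproxRealize.transfer hG (isModel_sigmaGMinus_of_theoryTGA hM)
      (isModel_sigmaGMinus_of_theoryTGA hN) hxy,
    Formula.ApproxRealize.transfer hG (isModel_sigmaGMinus_of_theoryTGA hN)
      (isModel_sigmaGMinus_of_theoryTGA hM) fun i j g => (hxy i j g).symm⟩

/-- The direct sum with ∞λ_G is again a representation, and its second summand makes the sentences
of Σ_G⁻ true. -/
theorem exists_embedding_theoryTGA (hG : IsAmenable G) {M : LGStructure.{u, v} G}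
    (hM : IsModel M (theoryTG G)) :
    ∃ N : LGStructure.{u, max u v} G, IsModel N (theoryTGA G) ∧ Nonempty (Embedding M N) := by
  obtain ⟨H, _, _, _, π, rfl⟩ := exists_eq_ofRep hM
  exact ⟨ofRep (prodRep π (inftyRegularRep G)),
    isModel_theoryTGA_of_sigmaGMinus hG (isModel_theoryTG_ofRep _)
      (isModel_sigmaGMinus_of_embedding (embeddingInr π (inftyRegularRep G))),
    ⟨embeddingInl π (inftyRegularRep G)⟩⟩

theorem isModelCompanion_theoryTGA (hG : IsAmenable G) :
    IsModelCompanion.{u, v} (theoryTGA G) (theoryTG G) := by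
  refine ⟨isModelComplete_theoryTGA hG, fun M hM => exists_embedding_theoryTGA hG hM,
    fun M hM => ?_⟩
  -- A model of T_GA is already a model of T_G; the direct sum serves to reach the universe `max u
  -- v`.
  obtain ⟨N, hN, hf⟩ := exists_embedding_theoryTGA hG (isModel_theoryTG_of_theoryTGA hM)
  exact ⟨N, isModel_theoryTG_of_theoryTGA hN, hf⟩

end Models

/-! ### Quantifier elimination -/

section QE

/-- The terms `⟨x_i, g x_j⟩`, `g ∈ F`, and the scalar variables. -/
def typeTerm {G : Type u} (F : Finset G) {m n : ℕ} :
    (Fin m × Fin m × F) ⊕ Fin n → Term G m n .scal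
  | .inl p => .sinner (.vvar p.1) (.vact p.2.2 (.vvar p.2.1))
  | .inr j => .svar j

/-- The formula saying that the values of `typeTerm` are within `√η` of given complex numbers. -/
def typeBox {G : Type u} (η : ℚ) (F : Finset G) {m n : ℕ}
    (q : (Fin m × Fin m × F) ⊕ Fin n → ℚ × ℚ) : Formula G m n :=
  boxFormula η ((Finset.univ : Finset ((Fin m × Fin m × F) ⊕ Fin n)).toList.map fun s =>
    (typeTerm F s, q s))

theorem realize_typeBox {G : Type u} {ε : ℚ} (hε : 0 ≤ ε) (F : Finset G) {m n : ℕ}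
    (q : (Fin m × Fin m × F) ⊕ Fin n → ℚ × ℚ) (M : LGStructure.{u, v} G) (x : Fin m → M.carrier)
    (z : Fin n → ℂ) : (typeBox (ε ^ 2) F q).Realize M x z ↔
      ∀ s, ‖(typeTerm F s).scalar M x z - ratComplex (q s)‖ ≤ (ε : ℝ) := by
  have hε' : (0 : ℝ) ≤ ε := by exact_mod_cast hε
  rw [typeBox, realize_boxFormula (by positivity), List.forall_mem_map]
  simp only [Finset.mem_toList, Finset.mem_univ, true_implies, Rat.cast_pow]
  exact forall_congr' fun s => sq_le_sq₀ (norm_nonneg _) hε'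

/-- Finitely many boxes with rational centers cover a ball. -/
theorem exists_finset_cover {S : Type u} [Fintype S] (R : ℝ) {ε : ℝ} (hε : 0 < ε) :
    ∃ t : Finset (S → ℚ × ℚ), ∀ a : S → ℂ, (∀ s, ‖a s‖ ≤ R) →
      ∃ q ∈ t, ∀ s, ‖a s - ratComplex (q s)‖ ≤ ε := by
  obtain ⟨t, ht⟩ := (isCompact_univ_pi fun _ : S => isCompact_closedBall (0 : ℂ) R).elim_finite_subcover
    (fun q : S → ℚ × ℚ => Metric.ball (fun s => ratComplex (q s)) ε) (fun _ => Metric.isOpen_ball)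
    (by
      intro a _
      choose q hq using fun s => exists_ratComplex_near (a s) hε
      refine Set.mem_iUnion.2 ⟨q, ?_⟩
      rw [Metric.mem_ball, dist_pi_lt_iff hε]
      exact fun s => by rw [dist_eq_norm]; exact hq s)
  refine ⟨t, fun a ha => ?_⟩
  obtain ⟨q, hq, h⟩ := Set.mem_iUnion₂.1
    (ht (show a ∈ _ from fun s _ => mem_closedBall_zero_iff.2 (ha s)))
  rw [Metric.mem_ball, dist_pi_lt_iff hε] at h
  exact ⟨q, hq, fun s => by rw [← dist_eq_norm]; exact (h s).le⟩

/-- Finitely many small boxes cover the bounded types restricted to F. The formula ψ is the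
disjunction of those boxes that meet the type of a bounded tuple satisfying φ in some model, and ψ'
doubles their radii. A tuple satisfying ψ' is then close to one satisfying φ, and transfer gives φ'.
-/
theorem hasQE_theoryTGA {G : Type u} [Group G] (hG : IsAmenable G) :
    HasQE.{u, v} (theoryTGA G) := by
  classical
  intro m n φ φ' hφ R
  obtain ⟨F, δ, hδ, hT⟩ := exists_transfers.{u, v, v} hG hφ ((R : ℚ) : ℝ)
  -- A point of a box and a point of a doubled box with the same centre differ by at most ε + 2ε < δ
  -- in each coordinate.
  obtain ⟨ε, hε, hεδ⟩ : ∃ ε : ℚ, (0 : ℝ) < ε ∧ (ε : ℝ) < δ / 4 := exists_rat_btwn (by positivity)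
  have hε0 : 0 < ε := by exact_mod_cast hε
  obtain ⟨t, ht⟩ := exists_finset_cover (S := (Fin m × Fin m × F) ⊕ Fin n)
    (max ((R : ℚ) : ℝ) (((R : ℚ) : ℝ) ^ 2)) hε
  let P : ((Fin m × Fin m × F) ⊕ Fin n → ℚ × ℚ) → Prop := fun q =>
    ∃ M : LGStructure.{u, v} G, IsModel M (theoryTGA G) ∧
      ∃ (x : Fin m → M.carrier) (z : Fin n → ℂ),
        (∀ i, ‖x i‖ ≤ ((R : ℚ) : ℝ)) ∧ (∀ j, ‖z j‖ ≤ ((R : ℚ) : ℝ)) ∧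
        φ.Realize M x z ∧ (typeBox (ε ^ 2) F q).Realize M x z
  obtain ⟨ψ', hψ', hψ'real⟩ := exists_approx_disjunction.{u, v} (t.filter P).toList
    (φ := typeBox (ε ^ 2) F) (φ' := typeBox ((2 * ε) ^ 2) F)
    (fun q => boxFormula_approx (by nlinarith) _)
  refine ⟨_, ψ', disjunction_isQF ?_, hψ', fun M hM x z hx hz => ⟨fun h => ?_, fun h => ?_⟩⟩
  · intro χ hχ
    obtain ⟨q, -, rfl⟩ := List.mem_map.1 hχ
    exact boxFormula_isQF _ _
  · obtain ⟨q, hq, hbox⟩ := ht (fun s => (typeTerm F s).scalar M x z) (by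
      obtain ⟨H, _, _, _, π, rfl⟩ := exists_eq_ofRep (isModel_theoryTG_of_theoryTGA hM)
      have h := qfType_mem_pi_closedBall π hx hz
      rintro (⟨i, j, g⟩ | j)
      · exact mem_closedBall_zero_iff.1 (h (.inl (i, j, g)) trivial)
      · exact mem_closedBall_zero_iff.1 (h (.inr j) trivial))
    have hbox' := (realize_typeBox hε0.le F q M x z).2 hbox
    refine realize_disjunction (List.mem_map.2 ⟨q, ?_, rfl⟩) hbox'
    exact Finset.mem_toList.2 (Finset.mem_filter.2 ⟨hq, M, hM, x, z, hx, hz, h, hbox'⟩)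
  · obtain ⟨q, hq, hbox⟩ := hψ'real M x z h
    obtain ⟨-, N, hN, y, z', hy, hz', hφy, hboxy⟩ := Finset.mem_filter.1 (Finset.mem_toList.1 hq)
    obtain ⟨H, _, _, _, π, rfl⟩ := exists_eq_ofRep (isModel_theoryTG_of_theoryTGA hM)
    obtain ⟨K, _, _, _, ρ, rfl⟩ := exists_eq_ofRep (isModel_theoryTG_of_theoryTGA hN)
    rw [realize_typeBox (by positivity)] at hbox hboxy
    push_cast at hbox
    have hclose : ∀ s, ‖(typeTerm F s).scalar (ofRep ρ) y z' -
        (typeTerm F s).scalar (ofRep π) x z‖ ≤ δ := by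
      intro s
      have h1 := hbox s
      have h2 := hboxy s
      rw [norm_sub_rev] at h1
      have h3 := norm_sub_le_norm_sub_add_norm_sub ((typeTerm F s).scalar (ofRep ρ) y z')
        (ratComplex (q s)) ((typeTerm F s).scalar (ofRep π) x z)
      linarith
    exact hT _ ρ _ π (isModel_sigmaGMinus_of_theoryTGA hN) (isModel_sigmaGMinus_of_theoryTGA hM)
      y x z' z hy hx hz' hz (fun i j g hg => hclose (.inl (i, j, ⟨g, hg⟩)))
      (fun j => hclose (.inr j)) hφy

end QE

end HilbRep

end

theorem mainTheorem3 (G : Type u) [Group G] [Countable G] (hG : HilbRep.IsAmenable G) :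
    HilbRep.HasQE.{u, v} (HilbRep.theoryTGA G) ∧
    HilbRep.Axiomatizes.{u, v} (HilbRep.theoryTG G ∪ HilbRep.sigmaGMinus G)
      (HilbRep.theoryTGA G) ∧
    HilbRep.IsModelCompanion.{u, v} (HilbRep.theoryTGA G) (HilbRep.theoryTG G) :=
  ⟨HilbRep.hasQE_theoryTGA hG, HilbRep.isModel_theoryTGA_iff hG,
    HilbRep.isModelCompanion_theoryTGA hG⟩
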